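/- Let $R$ be a commutative noetherian local ring with residue field $k$ and depth $t$; all modules are finitely generated. For a module $M$ with projective presentation $P_1\xrightarrow{\partial}P_0\to M\to 0$, the syzygy $\Omega M$ is the image of $\partial$ and the (Auslander) transpose $\operatorname{Tr}M$ is the cokernel of $\partial^*=\operatorname{Hom}_R(\partial,R)\colon P_0^*\to P_1^*$; both are determined by $M$ up to projective summands. Put $\Omega^0M=M$ and $\Omega^{n}M=\Omega(\Omega^{n-1}M)$ for $n>0$. Write $M\approx N$ if there are projective modules $P,Q$ with $M\oplus P\cong N\oplus Q$. Let $r(R)=\dim_k\operatorname{Ext}^t_R(k,R)$ be the type of $R$. Then there exists an exact sequence $0\to k\to W\to C\to 0$ of finitely generated $R$-modules such that $W$ has projective dimension exactly $t$ and $C\approx\operatorname{Tr}\Omega^{t+1}\operatorname{Tr}\Omega^{t}k$. Moreover, if $t>0$, then $W\approx\operatorname{Tr}\Omega^{t-1}(k^{\oplus r(R)})$. (These relations hold for every choice of the presentations used to form the syzygies and transposes.) -/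

import Mathlib

open CategoryTheory

universe u

namespace SyzygyTranspose

section StableCategory

variable {R : Type u} [CommRing R]

/-- `M ≈ N`: there are finitely generated projective modules `P`, `Q` with `M ⊕ P ≅ N ⊕ Q`. -/
def StablyIso (M N : ModuleCat.{u} R) : Prop :=
  ∃ P Q : ModuleCat.{u} R,
    Module.Finite R P ∧ Module.Projective R P ∧ Module.Finite R Q ∧ Module.Projective R Q ∧
      Nonempty ((M × P) ≃ₗ[R] (N × Q))

/-- `P₁ --d--> P₀ --p--> M → 0` is a presentation of `M` by finitely generated projective
modules. -/
structure IsProjPresentation {P₁ P₀ M : ModuleCat.{u} R}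
    (d : P₁ →ₗ[R] P₀) (p : P₀ →ₗ[R] M) : Prop where
  finite₁ : Module.Finite R P₁
  projective₁ : Module.Projective R P₁
  finite₀ : Module.Finite R P₀
  projective₀ : Module.Projective R P₀
  exact : Function.Exact d p
  surjective : Function.Surjective p

/-- `N` is a (first) syzygy `Ω M`: the image of `d`, for some finitely generated projective
presentation `P₁ --d--> P₀ → M → 0`. -/
def IsSyzygy (M N : ModuleCat.{u} R) : Prop :=
  ∃ (P₁ P₀ : ModuleCat.{u} R) (d : P₁ →ₗ[R] P₀) (p : P₀ →ₗ[R] M),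
    IsProjPresentation d p ∧ Nonempty (N ≃ₗ[R] LinearMap.range d)

/-- `N` is a transpose `Tr M`: the cokernel of `d* : P₀* → P₁*`, for some finitely generated
projective presentation `P₁ --d--> P₀ → M → 0`. -/
def IsTranspose (M N : ModuleCat.{u} R) : Prop :=
  ∃ (P₁ P₀ : ModuleCat.{u} R) (d : P₁ →ₗ[R] P₀) (p : P₀ →ₗ[R] M),
    IsProjPresentation d p ∧
      Nonempty (N ≃ₗ[R] (Module.Dual R P₁ ⧸ LinearMap.range d.dualMap))

/-- `N` is an `n`-th syzygy `Ωⁿ M`, where `Ω⁰ M = M` and `Ωⁿ⁺¹ M = Ω (Ωⁿ M)`. -/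
def IsNthSyzygy : ℕ → ModuleCat.{u} R → ModuleCat.{u} R → Prop
  | 0, M, N => Nonempty (N ≃ₗ[R] M)
  | n + 1, M, N => ∃ K : ModuleCat.{u} R, IsNthSyzygy n M K ∧ IsSyzygy K N

/-- `N` is a module `Tr Ωⁿ M`. -/
def IsTransposeSyzygy (n : ℕ) (M N : ModuleCat.{u} R) : Prop :=
  ∃ K : ModuleCat.{u} R, IsNthSyzygy n M K ∧ IsTranspose K N

theorem exists_isProjPresentation [IsNoetherianRing R] (M : ModuleCat.{u} R)
    [Module.Finite R M] :
    ∃ (P₁ P₀ : ModuleCat.{u} R) (d : P₁ →ₗ[R] P₀) (p : P₀ →ₗ[R] M),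
      IsProjPresentation d p := by
  obtain ⟨n, f, hf⟩ := Module.Finite.exists_fin' R M
  obtain ⟨m, g, hg⟩ := Module.Finite.exists_fin' R (LinearMap.ker f)
  refine ⟨ModuleCat.of R (Fin m → R), ModuleCat.of R (Fin n → R),
    (LinearMap.ker f).subtype ∘ₗ g, f, ?_⟩
  refine ⟨inferInstanceAs (Module.Finite R (Fin m → R)),
    inferInstanceAs (Module.Projective R (Fin m → R)),
    inferInstanceAs (Module.Finite R (Fin n → R)),
    inferInstanceAs (Module.Projective R (Fin n → R)), ?_, hf⟩
  intro x
  constructor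
  · intro hx
    obtain ⟨y, hy⟩ := hg ⟨x, hx⟩
    exact ⟨y, congrArg Subtype.val hy⟩
  · rintro ⟨y, rfl⟩
    exact (g y).2

/-- Syzygies of finitely generated modules exist and are finitely generated. -/
theorem exists_isNthSyzygy [IsNoetherianRing R] (n : ℕ) (M : ModuleCat.{u} R)
    [Module.Finite R M] : ∃ N : ModuleCat.{u} R, Module.Finite R N ∧ IsNthSyzygy n M N := by
  induction n with
  | zero => exact ⟨M, inferInstance, ⟨LinearEquiv.refl R M⟩⟩
  | succ n ih =>
    obtain ⟨K, hK, h⟩ := ih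
    obtain ⟨P₁, P₀, d, p, hd⟩ := exists_isProjPresentation K
    have := hd.finite₁
    exact ⟨ModuleCat.of R (LinearMap.range d), inferInstanceAs (Module.Finite R (LinearMap.range d)),
      K, h, P₁, P₀, d, p, hd, ⟨LinearEquiv.refl R _⟩⟩

/-- Modules `Tr Ωⁿ M` exist for finitely generated `M`, and are finitely generated. -/
theorem exists_isTransposeSyzygy [IsNoetherianRing R] (n : ℕ) (M : ModuleCat.{u} R)
    [Module.Finite R M] :
    ∃ N : ModuleCat.{u} R, Module.Finite R N ∧ IsTransposeSyzygy n M N := by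
  obtain ⟨K, hK, h⟩ := exists_isNthSyzygy n M
  obtain ⟨P₁, P₀, d, p, hd⟩ := exists_isProjPresentation K
  have := hd.finite₁
  have := hd.projective₁
  exact ⟨ModuleCat.of R (Module.Dual R P₁ ⧸ LinearMap.range d.dualMap),
    inferInstanceAs (Module.Finite R (Module.Dual R P₁ ⧸ LinearMap.range d.dualMap)),
    K, h, P₁, P₀, d, p, hd, ⟨LinearEquiv.refl R _⟩⟩

end StableCategory

section LocalRing

variable (R : Type u) [CommRing R] [IsLocalRing R]

/-- The depth of a local ring: the supremum of the lengths of the regular sequences contained in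
the maximal ideal. -/
noncomputable def ringDepth : ℕ∞ :=
  ⨆ rs ∈ {rs : List R |
    RingTheory.Sequence.IsRegular R rs ∧ ∀ r ∈ rs, r ∈ IsLocalRing.maximalIdeal R},
    (rs.length : ℕ∞)

/-- The residue field, as an `R`-module. -/
noncomputable abbrev residueModule : ModuleCat.{u} R := ModuleCat.of R (IsLocalRing.ResidueField R)

/-- The `R`-module `Extⁿ(k, R)`. -/
abbrev ExtResidue (n : ℕ) : Type u := Abelian.Ext (residueModule R) (ModuleCat.of R R) n

theorem isTorsionBySet_extResidue (n : ℕ) :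
    Module.IsTorsionBySet R (ExtResidue R n) (IsLocalRing.maximalIdeal R : Set R) := by
  rintro e ⟨r, hr⟩
  have h0 : r • 𝟙 (residueModule R) = 0 := by
    ext x
    have : algebraMap R (IsLocalRing.ResidueField R) r = 0 :=
      (IsLocalRing.residue_eq_zero_iff r).2 hr
    change r • x = 0
    rw [Algebra.smul_def, this, zero_mul]
  have h1 : r • e = (Abelian.Ext.mk₀ (r • 𝟙 (residueModule R))).comp e (zero_add n) := by
    simp [Abelian.Ext.mk₀_smul]
  change r • e = 0
  rw [h1, h0]
  simp

/-- The vector space structure over the residue field on `Extⁿ(k, R)` induced by its `R`-module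
structure. -/
@[reducible]
noncomputable def extResidueModule (n : ℕ) :
    Module (IsLocalRing.ResidueField R) (ExtResidue R n) :=
  (isTorsionBySet_extResidue R n).module

/-- The type `r(R)` of a local ring: the dimension over `k` of `Ext^{depth R}(k, R)`. -/
noncomputable def ringType : ℕ :=
  letI := extResidueModule R (ringDepth R).toNat
  Module.finrank (IsLocalRing.ResidueField R) (ExtResidue R (ringDepth R).toNat)

end LocalRing

end SyzygyTranspose

/-! Let `k` be the residue field and `r` the type. Since `Extⁱ(k, R) = 0` for `i < t`, dualising a
projective resolution `P` of `kʳ` with `P₀ = Rʳ` gives a complex `0 → P₀* → ... → P_t*` exact before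
its last term. Its cokernel `W` has projective dimension at most `t`, is `Tr Ωᵗ⁻¹ kʳ` when `t > 0`,
and carries the class `ω ∈ Extᵗ(W, Rʳ)` of the complex (`IsDualStage`, `exists_isDualStage`).

Composition with `ω` maps `Hom(k, W)` onto `Extᵗ(k, Rʳ)`, so some `i : k → W` is sent to the tuple
of a `k`-basis of `Extᵗ(k, R)`. The coordinates of `ω` generate `Extᵗ(W, R)` and, for `t > 0`, are
killed by the maximal ideal. Hence `i` induces a surjection `Extᵗ(W, R) → Extᵗ(k, R)`, bijective if
`t > 0`, and the long exact sequence gives `Extʲ(C, R) = 0` for `1 ≤ j ≤ t + 1`, where `C` is the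
cokernel of `i` (`exists_residueModule_embedding`). As `i ≠ 0`, the projective dimension of `W`
cannot be below `t`.

This vanishing gives `C ≈ Tr Ωᵗ⁺¹ Tr Ωᵗ⁺¹ C` (`IsTransposeSyzygy.stablyIso_of_isTransposeSyzygy`),
while `0 → k → W → C → 0` gives `Ωᵗ⁺¹ C ≈ Ωᵗ k` (`stablyIso_nthSyzygy_of_shortExact`). -/

namespace SyzygyTranspose

/-! ### Schanuel's lemma and cokernels of dual maps. -/

section ModuleLemmas

variable {R : Type u} [CommRing R]

/-- Schanuel's lemma. -/
theorem nonempty_ker_prod_equiv {X Y M : Type*} [AddCommGroup X] [AddCommGroup Y] [AddCommGroup M]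
    [Module R X] [Module R Y] [Module R M] [Module.Projective R X] [Module.Projective R Y]
    (f : X →ₗ[R] M) (g : Y →ₗ[R] M) (hf : Function.Surjective f) (hg : Function.Surjective g) :
    Nonempty ((LinearMap.ker f × Y) ≃ₗ[R] (LinearMap.ker g × X)) := by
  obtain ⟨s, hs⟩ := Module.projective_lifting_property f g hf
  obtain ⟨s', hs'⟩ := Module.projective_lifting_property g f hg
  have hs1 : ∀ y, f (s y) = g y := fun y => LinearMap.congr_fun hs y
  have hs2 : ∀ x, g (s' x) = f x := fun x => LinearMap.congr_fun hs' x
  refine ⟨{ toFun := fun z => (⟨z.2 - s' (z.1 + s z.2), ?_⟩, z.1 + s z.2)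
            invFun := fun z => (⟨z.2 - s (z.1 + s' z.2), ?_⟩, z.1 + s' z.2)
            map_add' := ?_, map_smul' := ?_, left_inv := ?_, right_inv := ?_ }⟩
  · simp [hs1, hs2]
  · intro a b
    ext <;> simp <;> abel
  · intro c a
    ext <;> simp [smul_sub, smul_add]
  · simp [hs1, hs2]
  · intro z
    ext <;> simp
  · intro z
    ext <;> simp

/-- The cokernel of the dual of `d`. -/
abbrev DualCoker {A B : Type*} [AddCommGroup A] [AddCommGroup B] [Module R A] [Module R B]
    (d : A →ₗ[R] B) : Type _ :=
  Module.Dual R A ⧸ LinearMap.range d.dualMap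

theorem nonempty_quotient_equiv {A N : Type*} [AddCommGroup A] [AddCommGroup N]
    [Module R A] [Module R N] (U : Submodule R A) (π : A →ₗ[R] N)
    (hπ : Function.Surjective π) (hU : LinearMap.ker π = U) : Nonempty ((A ⧸ U) ≃ₗ[R] N) := by
  subst hU
  exact ⟨π.quotKerEquivOfSurjective hπ⟩

section

variable {A B Z Q : Type*} [AddCommGroup A] [AddCommGroup B] [AddCommGroup Z] [AddCommGroup Q]
  [Module R A] [Module R B] [Module R Z] [Module R Q]

/-- A shear of `A × B` along `μ` turns `(d, d ∘ μ)` into `(d, 0)`, whose dual has the same image as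
`d*` in `A*` and misses `B*`. -/
theorem nonempty_dualCoker_coprod_left (d : A →ₗ[R] Z) (d' : B →ₗ[R] Z) (μ : B →ₗ[R] A)
    (h : d' = d ∘ₗ μ) :
    Nonempty (DualCoker (d.coprod d') ≃ₗ[R] (DualCoker d × Module.Dual R B)) := by
  subst h
  refine nonempty_quotient_equiv _
    (LinearMap.prod ((LinearMap.range d.dualMap).mkQ ∘ₗ (LinearMap.inl R A B).dualMap)
      ((LinearMap.inr R A B).dualMap - μ.dualMap ∘ₗ (LinearMap.inl R A B).dualMap)) ?_ ?_
  · rintro ⟨a, b⟩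
    obtain ⟨a, rfl⟩ := Submodule.mkQ_surjective _ a
    refine ⟨a.coprod (b + a ∘ₗ μ), ?_⟩
    refine Prod.ext ?_ ?_
    · change (LinearMap.range d.dualMap).mkQ _ = _
      congr 1
      ext x
      simp
    · ext x
      simp
  · ext φ
    simp only [LinearMap.mem_ker, LinearMap.prod_apply, Function.prod, Prod.mk_eq_zero,
      LinearMap.comp_apply, Submodule.mkQ_apply, Submodule.Quotient.mk_eq_zero,
      LinearMap.mem_range]
    constructor
    · rintro ⟨⟨ψ, hψ⟩, h2⟩
      refine ⟨ψ, ?_⟩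
      ext x
      · simpa using LinearMap.congr_fun hψ x
      · have h2 := LinearMap.congr_fun h2 x
        have h1 := LinearMap.congr_fun hψ (μ x)
        simp only [LinearMap.sub_apply, LinearMap.comp_apply, LinearMap.dualMap_apply,
          LinearMap.zero_apply, sub_eq_zero] at h1 h2
        simpa [h1] using h2.symm
    · rintro ⟨ψ, rfl⟩
      refine ⟨⟨ψ, ?_⟩, ?_⟩
      · ext x; simp
      · ext x; simp

theorem nonempty_dualCoker_coprod_right (d : A →ₗ[R] Z) (d' : B →ₗ[R] Z) (μ : A →ₗ[R] B)
    (h : d = d' ∘ₗ μ) :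
    Nonempty (DualCoker (d.coprod d') ≃ₗ[R] (DualCoker d' × Module.Dual R A)) := by
  obtain ⟨e⟩ := nonempty_dualCoker_coprod_left d' d μ h
  have h1 : d'.coprod d = (d.coprod d') ∘ₗ (LinearEquiv.prodComm R B A).toLinearMap := by
    ext <;> simp
  refine ⟨(Submodule.Quotient.equiv _ _ (LinearEquiv.prodComm R B A).dualMap ?_).trans e⟩
  rw [h1, ← LinearMap.dualMap_comp_dualMap, LinearMap.range_comp]
  rfl

theorem nonempty_dualCoker_prodMap_id (d : A →ₗ[R] Z) :
    Nonempty (DualCoker (d.prodMap (LinearMap.id : Q →ₗ[R] Q)) ≃ₗ[R] DualCoker d) := by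
  refine nonempty_quotient_equiv _
    ((LinearMap.range d.dualMap).mkQ ∘ₗ (LinearMap.inl R A Q).dualMap) ?_ ?_
  · refine (Submodule.mkQ_surjective _).comp fun a => ⟨a.coprod 0, ?_⟩
    ext x; simp
  · ext φ
    simp only [LinearMap.mem_ker, LinearMap.comp_apply, Submodule.mkQ_apply,
      Submodule.Quotient.mk_eq_zero, LinearMap.mem_range]
    constructor
    · rintro ⟨ψ, hψ⟩
      refine ⟨ψ.coprod (φ ∘ₗ LinearMap.inr R A Q), ?_⟩
      ext x
      · have h1 : φ (0, 0) = 0 := map_zero φ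
        simpa [h1] using LinearMap.congr_fun hψ x
      · simp
    · rintro ⟨ψ, rfl⟩
      refine ⟨ψ ∘ₗ LinearMap.inl R Z Q, ?_⟩
      ext x; simp

/-- The left inverse makes `β*` surjective. -/
theorem range_dualMap_comp_of_leftInverse (d : A →ₗ[R] Z) (β : Z →ₗ[R] B) (γ : B →ₗ[R] Z)
    (h : γ ∘ₗ β = LinearMap.id) :
    LinearMap.range (β ∘ₗ d).dualMap = LinearMap.range d.dualMap := by
  apply le_antisymm
  · rintro _ ⟨ψ, rfl⟩
    exact ⟨ψ ∘ₗ β, rfl⟩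
  · rintro _ ⟨ψ, rfl⟩
    refine ⟨ψ ∘ₗ γ, ?_⟩
    ext x
    simpa using congrArg ψ (LinearMap.congr_fun h (d x))

end

/-- Two maps between finitely generated projective modules with isomorphic cokernels have stably
isomorphic dual cokernels. -/
theorem exists_dualCoker_prod_equiv {A Z A' Z' M M' : Type u}
    [AddCommGroup A] [AddCommGroup Z] [AddCommGroup A'] [AddCommGroup Z'] [AddCommGroup M]
    [AddCommGroup M'] [Module R A] [Module R Z] [Module R A'] [Module R Z'] [Module R M]
    [Module R M'] [Module.Projective R A] [Module.Projective R Z] [Module.Projective R A']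
    [Module.Projective R Z'] {d : A →ₗ[R] Z} {p : Z →ₗ[R] M} {d' : A' →ₗ[R] Z'} {p' : Z' →ₗ[R] M'}
    (hd : Function.Exact d p) (hp : Function.Surjective p)
    (hd' : Function.Exact d' p') (hp' : Function.Surjective p') (e : M ≃ₗ[R] M') :
    Nonempty ((DualCoker d × Module.Dual R (A' × Z)) ≃ₗ[R]
      (DualCoker d' × Module.Dual R (A × Z'))) := by
  obtain ⟨l, hl⟩ := Module.projective_lifting_property p' (e.toLinearMap ∘ₗ p) hp'
  obtain ⟨l', hl'⟩ := Module.projective_lifting_property p (e.symm.toLinearMap ∘ₗ p') hp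
  have hl1 : ∀ z, p' (l z) = e (p z) := fun z => LinearMap.congr_fun hl z
  have hl2 : ∀ z, p (l' z) = e.symm (p' z) := fun z => LinearMap.congr_fun hl' z
  -- These shears move both presentations onto the common projective `Z × Z'`. The resulting maps
  -- `D` and `D'` have the same image, the kernel of `(z, z') ↦ e (p z) + p' z'`, so each factors
  -- through the other. The dual cokernel of `D.coprod D'` can then be computed from either side.
  let β : (Z × Z') →ₗ[R] (Z × Z') :=
    LinearMap.prod (LinearMap.fst R Z Z' - l' ∘ₗ LinearMap.snd R Z Z') (LinearMap.snd R Z Z')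
  let γ : (Z × Z') →ₗ[R] (Z × Z') :=
    LinearMap.prod (LinearMap.fst R Z Z' + l' ∘ₗ LinearMap.snd R Z Z') (LinearMap.snd R Z Z')
  let β' : (Z' × Z) →ₗ[R] (Z × Z') :=
    LinearMap.prod (LinearMap.snd R Z' Z) (LinearMap.fst R Z' Z - l ∘ₗ LinearMap.snd R Z' Z)
  let γ' : (Z × Z') →ₗ[R] (Z' × Z) :=
    LinearMap.prod (LinearMap.snd R Z Z' + l ∘ₗ LinearMap.fst R Z Z') (LinearMap.fst R Z Z')
  have hβ : γ ∘ₗ β = LinearMap.id := by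
    ext <;> simp [β, γ]
  have hβ' : γ' ∘ₗ β' = LinearMap.id := by
    ext <;> simp [β', γ']
  let D := β ∘ₗ d.prodMap (LinearMap.id : Z' →ₗ[R] Z')
  let D' := β' ∘ₗ d'.prodMap (LinearMap.id : Z →ₗ[R] Z)
  have hD : LinearMap.range D = LinearMap.range D' := by
    have h1 : ∀ z : Z × Z', z ∈ LinearMap.range D ↔ e (p z.1) + p' z.2 = 0 := by
      rintro ⟨z, z'⟩
      constructor
      · rintro ⟨⟨a, b⟩, h⟩
        simp only [D, β, LinearMap.comp_apply, LinearMap.prodMap_apply, LinearMap.prod_apply,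
          Function.prod, LinearMap.sub_apply, LinearMap.fst_apply, LinearMap.snd_apply,
          LinearMap.id_apply, Prod.mk.injEq] at h
        obtain ⟨rfl, rfl⟩ := h
        simp [hl2, hd.apply_apply_eq_zero]
      · intro h
        have : p (z + l' z') = 0 := by
          apply e.injective
          simpa [hl2] using h
        obtain ⟨a, ha⟩ := (hd _).1 this
        exact ⟨(a, z'), by simp [D, β, ha]⟩
    have h2 : ∀ z : Z × Z', z ∈ LinearMap.range D' ↔ e (p z.1) + p' z.2 = 0 := by
      rintro ⟨z, z'⟩
      constructor
      · rintro ⟨⟨a, b⟩, h⟩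
        simp only [D', β', LinearMap.comp_apply, LinearMap.prodMap_apply, LinearMap.prod_apply,
          Function.prod, LinearMap.sub_apply, LinearMap.fst_apply, LinearMap.snd_apply,
          LinearMap.id_apply, Prod.mk.injEq] at h
        obtain ⟨rfl, rfl⟩ := h
        simp [hl1, hd'.apply_apply_eq_zero]
      · intro h
        have : p' (z' + l z) = 0 := by
          simpa [hl1, add_comm] using h
        obtain ⟨a, ha⟩ := (hd' _).1 this
        exact ⟨(a, z), by simp [D', β', ha]⟩
    ext z
    rw [h1, h2]
  have key : ∀ {U V W : Type u} [AddCommGroup U] [AddCommGroup V] [AddCommGroup W] [Module R U]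
      [Module R V] [Module R W] [Module.Projective R V] (f : U →ₗ[R] W) (g : V →ₗ[R] W),
      LinearMap.range g ≤ LinearMap.range f → ∃ μ : V →ₗ[R] U, g = f ∘ₗ μ := by
    intro U V W _ _ _ _ _ _ _ f g h
    obtain ⟨μ, hμ⟩ := Module.projective_lifting_property f.rangeRestrict
      (g.codRestrict (LinearMap.range f) fun v => h ⟨v, rfl⟩) f.surjective_rangeRestrict
    refine ⟨μ, ?_⟩
    ext v
    exact (congrArg Subtype.val (LinearMap.congr_fun hμ v)).symm
  obtain ⟨μ, hμ⟩ := key D D' hD.ge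
  obtain ⟨μ', hμ'⟩ := key D' D hD.le
  obtain ⟨e₁⟩ := nonempty_dualCoker_coprod_left D D' μ hμ
  obtain ⟨e₂⟩ := nonempty_dualCoker_coprod_right D D' μ' hμ'
  obtain ⟨f₁⟩ := nonempty_dualCoker_prodMap_id (Q := Z') d
  obtain ⟨f₂⟩ := nonempty_dualCoker_prodMap_id (Q := Z) d'
  have g₁ : DualCoker D ≃ₗ[R] DualCoker d :=
    (Submodule.quotEquivOfEq _ _ (range_dualMap_comp_of_leftInverse _ β γ hβ)).trans f₁
  have g₂ : DualCoker D' ≃ₗ[R] DualCoker d' :=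
    (Submodule.quotEquivOfEq _ _ (range_dualMap_comp_of_leftInverse _ β' γ' hβ')).trans f₂
  exact ⟨(g₁.symm.prodCongr (LinearEquiv.refl R _)).trans <| e₁.symm.trans <| e₂.trans <|
    g₂.prodCongr (LinearEquiv.refl R _)⟩

end ModuleLemmas

/-! ### Stable invariance of syzygies and transposes. -/

section Stable

variable {R : Type u} [CommRing R]

theorem StablyIso.of_prod_equiv {M N : ModuleCat.{u} R} {P Q : Type u} [AddCommGroup P]
    [AddCommGroup Q] [Module R P] [Module R Q] [Module.Finite R P] [Module.Projective R P]
    [Module.Finite R Q] [Module.Projective R Q] (e : (M × P) ≃ₗ[R] (N × Q)) : StablyIso M N :=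
  ⟨ModuleCat.of R P, ModuleCat.of R Q, ‹_›, ‹_›, ‹_›, ‹_›, ⟨e⟩⟩

theorem StablyIso.of_equiv {M N : ModuleCat.{u} R} (e : M ≃ₗ[R] N) : StablyIso M N :=
  .of_prod_equiv (P := PUnit) (Q := PUnit) (e.prodCongr (LinearEquiv.refl R _))

theorem StablyIso.refl (M : ModuleCat.{u} R) : StablyIso M M :=
  .of_equiv (LinearEquiv.refl R M)

theorem StablyIso.symm {M N : ModuleCat.{u} R} (h : StablyIso M N) : StablyIso N M := by
  obtain ⟨P, Q, h₁, h₂, h₃, h₄, ⟨e⟩⟩ := h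
  exact ⟨Q, P, h₃, h₄, h₁, h₂, ⟨e.symm⟩⟩

theorem StablyIso.trans {M N L : ModuleCat.{u} R} (h : StablyIso M N) (h' : StablyIso N L) :
    StablyIso M L := by
  obtain ⟨P, Q, _, _, _, _, ⟨e⟩⟩ := h
  obtain ⟨P', Q', _, _, _, _, ⟨e'⟩⟩ := h'
  refine .of_prod_equiv (P := P × P') (Q := Q' × Q) ?_
  exact (LinearEquiv.prodAssoc R M P P').symm.trans <|
    (e.prodCongr (LinearEquiv.refl R P')).trans <|
    (LinearEquiv.prodAssoc R N Q P').trans <|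
    ((LinearEquiv.refl R N).prodCongr (LinearEquiv.prodComm R Q P')).trans <|
    (LinearEquiv.prodAssoc R N P' Q).symm.trans <|
    (e'.prodCongr (LinearEquiv.refl R Q)).trans (LinearEquiv.prodAssoc R L Q' Q)

theorem StablyIso.prod_self (M : ModuleCat.{u} R) (P : Type u) [AddCommGroup P] [Module R P]
    [Module.Finite R P] [Module.Projective R P] : StablyIso (ModuleCat.of R (M × P)) M :=
  .of_prod_equiv (P := PUnit) (Q := P) LinearEquiv.prodUnique

theorem IsProjPresentation.of_surjective [IsNoetherianRing R] {P M : ModuleCat.{u} R}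
    [Module.Finite R P] [Module.Projective R P] (p : P →ₗ[R] M) (hp : Function.Surjective p) :
    ∃ (m : ℕ) (d : ModuleCat.of R (Fin m → R) →ₗ[R] P), IsProjPresentation d p := by
  obtain ⟨m, g, hg⟩ := Module.Finite.exists_fin' R (LinearMap.ker p)
  refine ⟨m, (LinearMap.ker p).subtype ∘ₗ g, inferInstanceAs (Module.Finite R (Fin m → R)),
    inferInstanceAs (Module.Projective R (Fin m → R)), inferInstance, inferInstance, ?_, hp⟩
  rw [LinearMap.exact_iff]
  have : LinearMap.range g = ⊤ := LinearMap.range_eq_top.2 hg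
  rw [LinearMap.range_comp, this, Submodule.map_top, Submodule.range_subtype]

/-- With `IsSyzygy.exists_ker`, this replaces images of presentation maps by kernels of projective
surjections, the form Schanuel's lemma needs. -/
theorem IsSyzygy.of_ker [IsNoetherianRing R] {P M N : ModuleCat.{u} R}
    [Module.Finite R P] [Module.Projective R P] (p : P →ₗ[R] M) (hp : Function.Surjective p)
    (e : N ≃ₗ[R] LinearMap.ker p) : IsSyzygy M N := by
  obtain ⟨m, d, hd⟩ := IsProjPresentation.of_surjective p hp
  exact ⟨_, _, d, p, hd, ⟨e.trans (LinearEquiv.ofEq _ _ hd.exact.linearMap_ker_eq)⟩⟩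

theorem IsSyzygy.exists_ker {M N : ModuleCat.{u} R} (h : IsSyzygy M N) :
    ∃ (P : ModuleCat.{u} R) (p : P →ₗ[R] M), Module.Finite R P ∧ Module.Projective R P ∧
      Function.Surjective p ∧ Nonempty (N ≃ₗ[R] LinearMap.ker p) := by
  obtain ⟨P₁, P₀, d, p, hd, ⟨e⟩⟩ := h
  exact ⟨P₀, p, hd.finite₀, hd.projective₀, hd.surjective,
    ⟨e.trans (LinearEquiv.ofEq _ _ hd.exact.linearMap_ker_eq.symm)⟩⟩

theorem IsSyzygy.finite [IsNoetherianRing R] {M N : ModuleCat.{u} R} (h : IsSyzygy M N) :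
    Module.Finite R N := by
  obtain ⟨P, p, _, _, -, ⟨e⟩⟩ := h.exists_ker
  exact Module.Finite.equiv e.symm

theorem nonempty_ker_prodMap_equiv {P M Q : Type*} [AddCommGroup P] [AddCommGroup M]
    [AddCommGroup Q] [Module R P] [Module R M] [Module R Q] (p : P →ₗ[R] M) :
    Nonempty (LinearMap.ker (p.prodMap (LinearMap.id : Q →ₗ[R] Q)) ≃ₗ[R] LinearMap.ker p) := by
  refine ⟨{ toFun := fun z => ⟨z.1.1, ?_⟩
            invFun := fun z => ⟨(z.1, 0), ?_⟩
            map_add' := fun _ _ => rfl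
            map_smul' := fun _ _ => rfl
            left_inv := ?_
            right_inv := fun _ => rfl }⟩
  · exact (Prod.ext_iff.1 z.2).1
  · exact Prod.ext z.2 rfl
  · rintro ⟨⟨x, y⟩, h⟩
    have : y = 0 := (Prod.ext_iff.1 h).2
    simp [this]

theorem IsSyzygy.stablyIso {M M' N N' : ModuleCat.{u} R} (h : IsSyzygy M N) (h' : IsSyzygy M' N')
    (hM : StablyIso M M') : StablyIso N N' := by
  obtain ⟨P, p, _, _, hp, ⟨e⟩⟩ := h.exists_ker
  obtain ⟨P', p', _, _, hp', ⟨e'⟩⟩ := h'.exists_ker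
  obtain ⟨A, B, _, _, _, _, ⟨f⟩⟩ := hM
  obtain ⟨e₁⟩ := nonempty_ker_prodMap_equiv (Q := A) p
  obtain ⟨e₂⟩ := nonempty_ker_prodMap_equiv (Q := B) p'
  have hp₁ : Function.Surjective (p.prodMap (LinearMap.id : A →ₗ[R] A)) :=
    hp.prodMap Function.surjective_id
  have hp₂ : Function.Surjective (p'.prodMap (LinearMap.id : B →ₗ[R] B)) :=
    hp'.prodMap Function.surjective_id
  obtain ⟨g⟩ := nonempty_ker_prod_equiv (p.prodMap (LinearMap.id : A →ₗ[R] A))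
    (f.symm.toLinearMap ∘ₗ p'.prodMap (LinearMap.id : B →ₗ[R] B)) hp₁
    (f.symm.surjective.comp hp₂)
  refine .of_prod_equiv (P := P' × B) (Q := P × A) ?_
  exact ((e.trans e₁.symm).prodCongr (LinearEquiv.refl R _)).trans <| g.trans <|
    LinearEquiv.prodCongr ((LinearEquiv.ofEq _ _ (f.symm.ker_comp _)).trans (e₂.trans e'.symm))
      (LinearEquiv.refl R _)

theorem IsNthSyzygy.stablyIso {n : ℕ} {M M' N N' : ModuleCat.{u} R} (h : IsNthSyzygy n M N)
    (h' : IsNthSyzygy n M' N') (hM : StablyIso M M') : StablyIso N N' := by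
  induction n generalizing N N' with
  | zero =>
    obtain ⟨e⟩ := h
    obtain ⟨e'⟩ := h'
    exact (StablyIso.of_equiv e).trans (hM.trans (.of_equiv e'.symm))
  | succ n ih =>
    obtain ⟨K, hK, hN⟩ := h
    obtain ⟨K', hK', hN'⟩ := h'
    exact hN.stablyIso hN' (ih hK hK')

/-- `IsNthSyzygy` is recursive in the last syzygy taken; inductions that change the module `M` need
the first one split off. -/
theorem isNthSyzygy_one_add {n : ℕ} {M N : ModuleCat.{u} R} (h : IsNthSyzygy (n + 1) M N) :
    ∃ K : ModuleCat.{u} R, IsSyzygy M K ∧ IsNthSyzygy n K N := by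
  induction n generalizing N with
  | zero =>
    obtain ⟨K, ⟨e⟩, P₁, P₀, d, p, hd, ⟨f⟩⟩ := h
    refine ⟨N, ⟨P₁, P₀, d, e.toLinearMap ∘ₗ p, ⟨hd.finite₁, hd.projective₁, hd.finite₀,
      hd.projective₀, ?_, e.surjective.comp hd.surjective⟩, ⟨f⟩⟩, ⟨LinearEquiv.refl R N⟩⟩
    rw [LinearMap.exact_iff, LinearEquiv.ker_comp, hd.exact.linearMap_ker_eq]
  | succ n ih =>
    obtain ⟨K, hK, hN⟩ := h
    obtain ⟨L, hL, hLK⟩ := ih hK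
    exact ⟨L, hL, K, hLK, hN⟩

theorem IsNthSyzygy.comp_isSyzygy {n : ℕ} {M K N : ModuleCat.{u} R} (hK : IsSyzygy M K)
    (h : IsNthSyzygy n K N) : IsNthSyzygy (n + 1) M N := by
  induction n generalizing N with
  | zero =>
    obtain ⟨e⟩ := h
    obtain ⟨P₁, P₀, d, p, hd, ⟨f⟩⟩ := hK
    exact ⟨M, ⟨LinearEquiv.refl R M⟩, P₁, P₀, d, p, hd, ⟨e.trans f⟩⟩
  | succ n ih =>
    obtain ⟨L, hL, hN⟩ := h
    exact ⟨L, ih hL, hN⟩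

theorem IsTranspose.stablyIso {M M' N N' : ModuleCat.{u} R} (h : IsTranspose M N)
    (h' : IsTranspose M' N') (hM : StablyIso M M') : StablyIso N N' := by
  obtain ⟨P₁, P₀, d, p, hd, ⟨e⟩⟩ := h
  obtain ⟨P₁', P₀', d', p', hd', ⟨e'⟩⟩ := h'
  obtain ⟨A, B, _, _, _, _, ⟨f⟩⟩ := hM
  have := hd.finite₁
  have := hd.finite₀
  have := hd.projective₁
  have := hd.projective₀
  have := hd'.finite₁
  have := hd'.finite₀
  have := hd'.projective₁
  have := hd'.projective₀
  have key : ∀ {P₁ P₀ M : ModuleCat.{u} R} (A : ModuleCat.{u} R) {d : P₁ →ₗ[R] P₀}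
      {p : P₀ →ₗ[R] M}, IsProjPresentation d p →
      Function.Exact (LinearMap.inl R P₀ A ∘ₗ d) (p.prodMap (LinearMap.id : A →ₗ[R] A)) := by
    rintro P₁ P₀ M A d p hd ⟨x, a⟩
    constructor
    · intro h
      obtain ⟨y, rfl⟩ := (hd.exact x).1 (Prod.ext_iff.1 h).1
      obtain rfl : a = 0 := (Prod.ext_iff.1 h).2
      exact ⟨y, rfl⟩
    · rintro ⟨y, h⟩
      rw [← h]
      exact Prod.ext (hd.exact.apply_apply_eq_zero y) rfl
  obtain ⟨g⟩ := exists_dualCoker_prod_equiv (key A hd)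
    (hd.surjective.prodMap Function.surjective_id) (key B hd')
    (hd'.surjective.prodMap Function.surjective_id) f
  have h₁ := range_dualMap_comp_of_leftInverse d (LinearMap.inl R P₀ A) (LinearMap.fst R P₀ A)
    (LinearMap.fst_comp_inl R P₀ A)
  have h₂ := range_dualMap_comp_of_leftInverse d' (LinearMap.inl R P₀' B) (LinearMap.fst R P₀' B)
    (LinearMap.fst_comp_inl R P₀' B)
  refine .of_prod_equiv ?_ (P := Module.Dual R (P₁' × (P₀ × A)))
    (Q := Module.Dual R (P₁ × (P₀' × B)))
  exact ((e.trans (Submodule.quotEquivOfEq _ _ h₁.symm)).prodCongr (LinearEquiv.refl R _)).trans <|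
    g.trans <| ((Submodule.quotEquivOfEq _ _ h₂).trans e'.symm).prodCongr (LinearEquiv.refl R _)

theorem IsTransposeSyzygy.stablyIso {n : ℕ} {M M' N N' : ModuleCat.{u} R}
    (h : IsTransposeSyzygy n M N) (h' : IsTransposeSyzygy n M' N') (hM : StablyIso M M') :
    StablyIso N N' := by
  obtain ⟨K, hK, hN⟩ := h
  obtain ⟨K', hK', hN'⟩ := h'
  exact hN.stablyIso hN' (hK.stablyIso hK' hM)

theorem IsTranspose.finite {M N : ModuleCat.{u} R} (h : IsTranspose M N) : Module.Finite R N := by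
  obtain ⟨P₁, P₀, d, p, hd, ⟨e⟩⟩ := h
  have := hd.finite₁
  have := hd.projective₁
  exact Module.Finite.equiv e.symm

theorem IsProjPresentation.dual {P₁ P₀ M : ModuleCat.{u} R} {d : P₁ →ₗ[R] P₀} {p : P₀ →ₗ[R] M}
    (hd : IsProjPresentation d p) {N : ModuleCat.{u} R} (e : N ≃ₗ[R] DualCoker d) :
    IsProjPresentation (P₁ := ModuleCat.of R (Module.Dual R P₀))
      (P₀ := ModuleCat.of R (Module.Dual R P₁)) d.dualMap
      (e.symm.toLinearMap ∘ₗ (LinearMap.range d.dualMap).mkQ) := by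
  have := hd.finite₁
  have := hd.finite₀
  have := hd.projective₁
  have := hd.projective₀
  refine ⟨inferInstanceAs (Module.Finite R (Module.Dual R P₀)),
    inferInstanceAs (Module.Projective R (Module.Dual R P₀)),
    inferInstanceAs (Module.Finite R (Module.Dual R P₁)),
    inferInstanceAs (Module.Projective R (Module.Dual R P₁)), ?_,
    e.symm.surjective.comp (Submodule.mkQ_surjective _)⟩
  rw [LinearMap.exact_iff, LinearEquiv.ker_comp, Submodule.ker_mkQ]

/-- `Tr Tr M ≈ M`. -/
theorem IsTranspose.stablyIso_of_isTranspose {M N L : ModuleCat.{u} R} (h : IsTranspose M N)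
    (h' : IsTranspose N L) : StablyIso M L := by
  obtain ⟨P₁, P₀, d, p, hd, ⟨e⟩⟩ := h
  have := hd.finite₁
  have := hd.finite₀
  have := hd.projective₁
  have := hd.projective₀
  refine IsTranspose.stablyIso (M := N) ⟨_, _, _, _, hd.dual e, ?_⟩ h' (.refl N)
  -- Finitely generated projectives are reflexive, so evaluation identifies `d**` with `d`, and its
  -- cokernel is `M`.
  obtain ⟨f⟩ := nonempty_quotient_equiv (LinearMap.range d.dualMap.dualMap)
    (p ∘ₗ (Module.evalEquiv R P₀).symm.toLinearMap)
    (hd.surjective.comp (Module.evalEquiv R P₀).symm.surjective) (by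
      have h1 : ∀ x, d.dualMap.dualMap (Module.evalEquiv R P₁ x) = Module.evalEquiv R P₀ (d x) :=
        fun x => by ext; rfl
      ext φ
      obtain ⟨x, rfl⟩ := (Module.evalEquiv R P₀).surjective φ
      simp only [LinearMap.mem_ker, LinearMap.comp_apply, LinearEquiv.coe_coe,
        LinearEquiv.symm_apply_apply, LinearMap.mem_range]
      rw [hd.exact x]
      constructor
      · rintro ⟨y, rfl⟩
        exact ⟨_, h1 y⟩
      · rintro ⟨ψ, hψ⟩
        obtain ⟨y, rfl⟩ := (Module.evalEquiv R P₁).surjective ψ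
        exact ⟨y, (Module.evalEquiv R P₀).injective ((h1 y).symm.trans hψ)⟩)
  exact ⟨f.symm⟩

/-- If every functional on `Ω D` extends, then `Ω Tr Ω D ≈ Tr D`. -/
theorem stablyIso_of_isSyzygy_transpose [IsNoetherianRing R] {D K A B L : ModuleCat.{u} R}
    (hD : ∀ (P₁ P₀ : ModuleCat.{u} R) (d : P₁ →ₗ[R] P₀) (p : P₀ →ₗ[R] D), IsProjPresentation d p →
      ∀ f : P₁ →ₗ[R] R, LinearMap.ker d ≤ LinearMap.ker f → f ∈ LinearMap.range d.dualMap)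
    (hK : IsSyzygy D K) (hA : IsTranspose K A) (hB : IsSyzygy A B) (hL : IsTranspose D L) :
    StablyIso B L := by
  obtain ⟨P₁, P₀, d, p, hd, ⟨e⟩⟩ := hL
  have := hd.finite₁
  have := hd.finite₀
  have := hd.projective₁
  have := hd.projective₀
  obtain ⟨m, d₂, hd₂⟩ := IsProjPresentation.of_surjective (M := ModuleCat.of R (LinearMap.range d))
    d.rangeRestrict d.surjective_rangeRestrict
  let A' : ModuleCat.{u} R := ModuleCat.of R (DualCoker d₂)
  have hA' : IsTranspose (ModuleCat.of R (LinearMap.range d)) A' :=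
    ⟨_, _, d₂, _, hd₂, ⟨LinearEquiv.refl R _⟩⟩
  have hDK : IsSyzygy D (ModuleCat.of R (LinearMap.range d)) :=
    ⟨_, _, d, p, hd, ⟨LinearEquiv.refl R _⟩⟩
  have hAA' : StablyIso A A' := hA.stablyIso hA' (hK.stablyIso hDK (.refl D))
  refine hB.stablyIso ⟨_, _, _, _, hd₂.dual (LinearEquiv.refl R _), ?_⟩ hAA'
  -- The kernel of `d₂*` consists of the functionals on `Ω D`, and these extend to `P₀` by `hD`.
  -- Hence `Tr D = P₁* / im d*` is the image of `d₂*`, which is a syzygy of `Tr Ω D`.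
  have hker : LinearMap.ker d₂.dualMap = LinearMap.range d.dualMap := by
    apply le_antisymm
    · intro f hf
      refine hD _ _ d p hd f fun x hx => ?_
      obtain ⟨y, rfl⟩ := (hd₂.exact x).1 (Subtype.ext hx)
      exact LinearMap.congr_fun hf y
    · rintro _ ⟨g, rfl⟩
      ext y
      change g (d (d₂ _)) = 0
      rw [show d (d₂ _) = 0 from congrArg Subtype.val (hd₂.exact.apply_apply_eq_zero _), map_zero]
  exact ⟨e.trans <| (Submodule.quotEquivOfEq _ _ hker.symm).trans
    d₂.dualMap.quotKerEquivRange⟩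

end Stable

/-! ### Ext, syzygies and transposes along short exact sequences. -/

section Exact

open Abelian

variable {R : Type u} [CommRing R]

/-- The short complex of modules given by an exact pair of linear maps. -/
abbrev shortComplexOfExact {A B C : ModuleCat.{u} R} (f : A →ₗ[R] B) (g : B →ₗ[R] C)
    (h : Function.Exact f g) : ShortComplex (ModuleCat.{u} R) :=
  ShortComplex.mk (X₁ := A) (X₂ := B) (X₃ := C) (ModuleCat.ofHom f) (ModuleCat.ofHom g)
    (ModuleCat.hom_ext h.linearMap_comp_eq_zero)

theorem shortExact_of_exact {A B C : ModuleCat.{u} R} {f : A →ₗ[R] B} {g : B →ₗ[R] C}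
    (hf : Function.Injective f) (h : Function.Exact f g) (hg : Function.Surjective g) :
    (shortComplexOfExact f g h).ShortExact where
  exact := (ShortComplex.ShortExact.moduleCat_exact_iff_function_exact _).2 h
  mono_f := (ModuleCat.mono_iff_injective _).2 hf
  epi_g := (ModuleCat.epi_iff_surjective _).2 hg

theorem exact_subtype_ker {A B : Type*} [AddCommGroup A] [AddCommGroup B] [Module R A] [Module R B]
    (p : A →ₗ[R] B) : Function.Exact (LinearMap.ker p).subtype p := by
  rw [LinearMap.exact_iff, Submodule.range_subtype]

theorem shortExact_ker {P M : ModuleCat.{u} R} {p : P →ₗ[R] M} (hp : Function.Surjective p) :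
    (shortComplexOfExact (A := ModuleCat.of R (LinearMap.ker p)) (LinearMap.ker p).subtype p
      (exact_subtype_ker p)).ShortExact :=
  shortExact_of_exact (A := ModuleCat.of R (LinearMap.ker p)) (Submodule.subtype_injective _)
    (exact_subtype_ker p) hp

theorem exists_extension_of_subsingleton_ext {A B C Y : ModuleCat.{u} R} {f : A →ₗ[R] B}
    {g : B →ₗ[R] C} (hf : Function.Injective f) (h : Function.Exact f g)
    (hg : Function.Surjective g) [Subsingleton (Ext C Y 1)] (φ : A →ₗ[R] Y) :
    ∃ ψ : B →ₗ[R] Y, ψ ∘ₗ f = φ := by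
  obtain ⟨x, hx⟩ := Ext.contravariant_sequence_exact₁ (shortExact_of_exact hf h hg) Y
    (Ext.mk₀ (ModuleCat.ofHom φ : A ⟶ Y)) (add_zero 1) (Subsingleton.elim (α := Ext C Y 1) _ _)
  obtain ⟨ψ, rfl⟩ := (Ext.mk₀_bijective _ _).2 x
  rw [Ext.mk₀_comp_mk₀] at hx
  exact ⟨ψ.hom, congrArg ModuleCat.Hom.hom ((Ext.mk₀_bijective _ _).1 hx)⟩

theorem subsingleton_ext_X₁ {S : ShortComplex (ModuleCat.{u} R)} (hS : S.ShortExact)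
    {Y : ModuleCat.{u} R} {i j : ℕ} (hij : 1 + i = j) [Subsingleton (Ext S.X₂ Y i)]
    [Subsingleton (Ext S.X₃ Y j)] : Subsingleton (Ext S.X₁ Y i) := by
  refine subsingleton_of_forall_eq 0 fun x => ?_
  obtain ⟨y, rfl⟩ := Ext.contravariant_sequence_exact₁ hS Y x hij (Subsingleton.elim _ _)
  rw [Subsingleton.elim y 0, Ext.comp_zero]

theorem subsingleton_ext_X₃ {S : ShortComplex (ModuleCat.{u} R)} (hS : S.ShortExact)
    {Y : ModuleCat.{u} R} {i j : ℕ} (hij : 1 + i = j) [Subsingleton (Ext S.X₁ Y i)]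
    [Subsingleton (Ext S.X₂ Y j)] : Subsingleton (Ext S.X₃ Y j) := by
  refine subsingleton_of_forall_eq 0 fun x => ?_
  obtain ⟨y, rfl⟩ := Ext.contravariant_sequence_exact₃ hS Y x (Subsingleton.elim _ _) hij
  rw [Subsingleton.elim y 0, Ext.comp_zero]

theorem subsingleton_ext_of_projective (P Y : ModuleCat.{u} R) [Module.Projective R P] (i : ℕ) :
    Subsingleton (Ext P Y (i + 1)) :=
  have : Projective P := P.projective_of_categoryTheory_projective
  subsingleton_of_forall_eq 0 fun x => x.eq_zero_of_projective

theorem subsingleton_ext_of_equiv {M N Y : ModuleCat.{u} R} (e : M ≃ₗ[R] N) {i : ℕ}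
    [Subsingleton (Ext N Y i)] : Subsingleton (Ext M Y i) := by
  refine subsingleton_of_forall_eq 0 fun x => ?_
  have h : x = (Ext.mk₀ e.toModuleIso.hom).comp ((Ext.mk₀ e.toModuleIso.inv).comp x (zero_add i))
      (zero_add i) := by
    rw [Ext.mk₀_comp_mk₀_assoc, Iso.hom_inv_id, Ext.mk₀_id_comp]
  rw [h, Subsingleton.elim ((Ext.mk₀ e.toModuleIso.inv).comp x (zero_add i)) 0, Ext.comp_zero]

theorem IsSyzygy.subsingleton_ext {M K Y : ModuleCat.{u} R} (h : IsSyzygy M K) {i : ℕ}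
    [Subsingleton (Ext M Y (i + 2))] : Subsingleton (Ext K Y (i + 1)) := by
  obtain ⟨P, p, _, _, hp, ⟨e⟩⟩ := h.exists_ker
  have := subsingleton_ext_of_projective P Y i
  have : Subsingleton (Ext (ModuleCat.of R (LinearMap.ker p)) Y (i + 1)) :=
    subsingleton_ext_X₁ (shortExact_ker hp) (j := i + 2) (by omega)
  exact subsingleton_ext_of_equiv (N := ModuleCat.of R (LinearMap.ker p)) e

theorem IsNthSyzygy.subsingleton_ext {n : ℕ} {M K Y : ModuleCat.{u} R} (h : IsNthSyzygy n M K)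
    {i : ℕ} [hM : Subsingleton (Ext M Y (i + n + 1))] : Subsingleton (Ext K Y (i + 1)) := by
  induction n generalizing K i with
  | zero =>
    obtain ⟨e⟩ := h
    exact subsingleton_ext_of_equiv e
  | succ n ih =>
    obtain ⟨L, hL, hK⟩ := h
    have : Subsingleton (Ext M Y ((i + 1) + n + 1)) := by
      rwa [show (i + 1) + n + 1 = i + (n + 1) + 1 by omega]
    have := ih hL (i := i + 1)
    exact hK.subsingleton_ext

theorem hasProjectiveDimensionLT_prod {M P : ModuleCat.{u} R} {n : ℕ}
    [HasProjectiveDimensionLT M (n + 1)] [Module.Projective R P] :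
    HasProjectiveDimensionLT (ModuleCat.of R (M × P)) (n + 1) := by
  have : Projective P := P.projective_of_categoryTheory_projective
  have hP : HasProjectiveDimensionLT P (n + 1) :=
    hasProjectiveDimensionLT_of_ge P 1 (n + 1) (by omega)
  refine ShortComplex.ShortExact.hasProjectiveDimensionLT_X₂
    (shortExact_of_exact (B := ModuleCat.of R (M × P)) (f := LinearMap.inl R M P)
      (g := LinearMap.snd R M P) LinearMap.inl_injective ?_ LinearMap.snd_surjective) (n + 1)
      ‹_› hP
  exact Function.Exact.inl_snd

/-- An exact sequence `0 → A → B → C → 0` and a projective cover `P → C` give an exact sequence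
`0 → Ω C → A × P → B → 0`. -/
theorem exists_exact_ker_prod {A B C P : Type*} [AddCommGroup A] [AddCommGroup B] [AddCommGroup C]
    [AddCommGroup P] [Module R A] [Module R B] [Module R C] [Module R P] [Module.Projective R P]
    {f : A →ₗ[R] B} {g : B →ₗ[R] C} (hf : Function.Injective f) (h : Function.Exact f g)
    (hg : Function.Surjective g) (p : P →ₗ[R] C) (hp : Function.Surjective p) :
    ∃ (f' : LinearMap.ker p →ₗ[R] A × P) (g' : A × P →ₗ[R] B),
      Function.Injective f' ∧ Function.Exact f' g' ∧ Function.Surjective g' := by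
  obtain ⟨l, hl⟩ := Module.projective_lifting_property g p hg
  have hl : ∀ x, g (l x) = p x := fun x => LinearMap.congr_fun hl x
  let e := LinearEquiv.ofInjective f hf
  have he : ∀ y, f (e.symm y) = y := fun y => congrArg Subtype.val (e.apply_symm_apply y)
  let k : LinearMap.ker p →ₗ[R] LinearMap.range f :=
    LinearMap.codRestrict _ (l ∘ₗ (LinearMap.ker p).subtype) fun z =>
      (h _).1 ((hl _).trans z.2)
  refine ⟨LinearMap.prod (-(e.symm.toLinearMap ∘ₗ k)) (LinearMap.ker p).subtype, f.coprod l,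
    ?_, ?_, ?_⟩
  · intro x y hxy
    exact Subtype.ext (Prod.ext_iff.1 hxy).2
  · rintro ⟨a, x⟩
    constructor
    · intro hax
      have h1 : f a + l x = 0 := hax
      have h2 : p x = 0 := by
        have := congrArg g h1
        rwa [map_add, h.apply_apply_eq_zero, zero_add, hl, map_zero] at this
      refine ⟨⟨x, h2⟩, Prod.ext (hf ?_) rfl⟩
      change f (-(e.symm (k ⟨x, h2⟩))) = f a
      rw [map_neg, he]
      exact (eq_neg_of_add_eq_zero_left h1).symm
    · rintro ⟨z, hz⟩
      rw [← hz]
      change f (-(e.symm (k z))) + l z = 0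
      rw [map_neg, he]
      exact neg_add_cancel _
  · intro b
    obtain ⟨x, hx⟩ := hp (g b)
    obtain ⟨a, ha⟩ := (h (b - l x)).1 (by rw [map_sub, hl, hx, sub_self])
    exact ⟨(a, x), by simp [ha]⟩

/-- If `0 → A → B → C → 0` is exact and `B` has projective dimension at most `n`, then
`Ωⁿ⁺¹ C ≈ Ωⁿ A`. -/
theorem stablyIso_nthSyzygy_of_shortExact [IsNoetherianRing R] {n : ℕ}
    {A B C N N' : ModuleCat.{u} R}
    [Module.Finite R A] [Module.Finite R B] [Module.Finite R C]
    {f : A →ₗ[R] B} {g : B →ₗ[R] C} (hf : Function.Injective f) (h : Function.Exact f g)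
    (hg : Function.Surjective g) (hB : HasProjectiveDimensionLT B (n + 1))
    (hN : IsNthSyzygy (n + 1) C N) (hN' : IsNthSyzygy n A N') : StablyIso N N' := by
  induction n generalizing A B C N N' with
  | zero =>
    have : Projective B := projective_iff_hasProjectiveDimensionLT_one.2 hB
    have : Module.Projective R B := B.projective_of_module_projective
    have hA : IsSyzygy C A := .of_ker g hg
      ((LinearEquiv.ofInjective f hf).trans (LinearEquiv.ofEq _ _ h.linearMap_ker_eq.symm))
    exact hN.stablyIso (n := 1) (.comp_isSyzygy (n := 0) hA hN') (.refl C)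
  | succ n ih =>
    -- Three rotations turn `0 → A → B → C → 0` into `0 → ΩA → ΩB ⊕ F₃ → ΩC ⊕ F₂ → 0` with `F₂`,
    -- `F₃` free. The middle term has lost one from its bound on projective dimension, so induction
    -- applies.
    obtain ⟨m₁, p₁, hp₁⟩ := Module.Finite.exists_fin' R C
    obtain ⟨f₁, g₁, hf₁, h₁, hg₁⟩ := exists_exact_ker_prod hf h hg p₁ hp₁
    obtain ⟨m₂, p₂, hp₂⟩ := Module.Finite.exists_fin' R B
    obtain ⟨f₂, g₂, hf₂, h₂, hg₂⟩ := exists_exact_ker_prod hf₁ h₁ hg₁ p₂ hp₂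
    obtain ⟨m₃, p₃, hp₃⟩ := Module.Finite.exists_fin' R (A × (Fin m₁ → R))
    obtain ⟨f₃, g₃, hf₃, h₃, hg₃⟩ := exists_exact_ker_prod hf₂ h₂ hg₂ p₃ hp₃
    let K₁ := ModuleCat.of R (LinearMap.ker p₁)
    let K₂ := ModuleCat.of R (LinearMap.ker p₂)
    let K₃ := ModuleCat.of R (LinearMap.ker p₃)
    have hK₂ : HasProjectiveDimensionLT K₂ (n + 1) := by
      have hP : Projective (ModuleCat.of R (Fin m₂ → R)) :=
        ModuleCat.projective_of_categoryTheory_projective _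
      have hP : HasProjectiveDimensionLT (ModuleCat.of R (Fin m₂ → R)) (n + 1) :=
        hasProjectiveDimensionLT_of_ge _ 1 (n + 1) (by omega)
      exact (shortExact_ker (P := ModuleCat.of R (Fin m₂ → R)) hp₂).hasProjectiveDimensionLT_X₁
        (n + 1) hP hB
    have hB' : HasProjectiveDimensionLT (ModuleCat.of R (K₂ × (Fin m₃ → R))) (n + 1) :=
      hasProjectiveDimensionLT_prod (M := K₂) (P := ModuleCat.of R (Fin m₃ → R))
    have s₁ : IsSyzygy C K₁ := .of_ker (P := ModuleCat.of R (Fin m₁ → R)) p₁ hp₁ (.refl R _)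
    have s₃ : IsSyzygy (ModuleCat.of R (A × (Fin m₁ → R))) K₃ :=
      .of_ker (P := ModuleCat.of R (Fin m₃ → R)) p₃ hp₃ (.refl R _)
    obtain ⟨K, hCK, hKN⟩ := isNthSyzygy_one_add hN
    obtain ⟨K', hAK', hKN'⟩ := isNthSyzygy_one_add hN'
    obtain ⟨L, -, hL⟩ := exists_isNthSyzygy (n + 1) (ModuleCat.of R (K₁ × (Fin m₂ → R)))
    obtain ⟨L', -, hL'⟩ := exists_isNthSyzygy n K₃
    have e₁ : StablyIso N L := hKN.stablyIso hL
      ((hCK.stablyIso s₁ (.refl C)).trans (StablyIso.prod_self K₁ (Fin m₂ → R)).symm)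
    have e₂ : StablyIso N' L' := hKN'.stablyIso hL'
      (hAK'.stablyIso s₃ (StablyIso.prod_self A (Fin m₁ → R)).symm)
    exact e₁.trans ((ih (A := K₃) (B := ModuleCat.of R (K₂ × (Fin m₃ → R)))
      (C := ModuleCat.of R (K₁ × (Fin m₂ → R))) hf₃ h₃ hg₃ hB' hL hL').trans e₂.symm)

/-- If `Extⁱ(M, R) = 0` for `1 ≤ i ≤ n`, then `Ωⁿ Tr Ωⁿ M ≈ Tr M`. -/
theorem IsTransposeSyzygy.stablyIso_transpose [IsNoetherianRing R] {n : ℕ}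
    {M A B L : ModuleCat.{u} R} [Module.Finite R M]
    (hM : ∀ i < n, Subsingleton (Ext M (ModuleCat.of R R) (i + 1)))
    (hA : IsTransposeSyzygy n M A) (hB : IsNthSyzygy n A B) (hL : IsTranspose M L) :
    StablyIso B L := by
  induction n generalizing A B with
  | zero =>
    obtain ⟨K, ⟨e⟩, hK⟩ := hA
    obtain ⟨f⟩ := hB
    exact (StablyIso.of_equiv f).trans (hK.stablyIso hL (.of_equiv e))
  | succ n ih =>
    obtain ⟨K, ⟨D, hD, hK⟩, hA⟩ := hA
    obtain ⟨B₁, hB₁, hB⟩ := isNthSyzygy_one_add hB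
    have hDfin : Module.Finite R D := by
      cases n with
      | zero => exact Module.Finite.equiv hD.some.symm
      | succ n =>
        obtain ⟨D', -, h⟩ := hD
        exact h.finite
    obtain ⟨T, hTfin, hT⟩ : ∃ T : ModuleCat.{u} R, Module.Finite R T ∧ IsTranspose D T := by
      obtain ⟨P₁, P₀, d, p, hd⟩ := exists_isProjPresentation D
      have h : IsTranspose D (ModuleCat.of R (DualCoker d)) :=
        ⟨P₁, P₀, d, p, hd, ⟨LinearEquiv.refl R _⟩⟩
      exact ⟨_, h.finite, h⟩
    obtain ⟨B', -, hB'⟩ := exists_isNthSyzygy n T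
    have := hM n (by omega)
    have : Subsingleton (Ext M (ModuleCat.of R R) (0 + n + 1)) := by rwa [zero_add]
    -- Here `D = Ωⁿ M`, so this is dimension shifting from `Extⁿ⁺¹(M, R) = 0`. It makes functionals
    -- on `Ω D` extend, whence `Ω Tr Ω D ≈ Tr D`; the other `n` syzygies are left to the induction.
    have hext : Subsingleton (Ext D (ModuleCat.of R R) 1) := hD.subsingleton_ext (i := 0)
    refine (hB.stablyIso hB' (stablyIso_of_isSyzygy_transpose ?_ hK hA hB₁ hT)).trans
      (ih (fun i hi => hM i (by omega)) ⟨D, hD, hT⟩ hB')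
    intro P₁ P₀ d p hd f hf
    obtain ⟨ψ, hψ⟩ := exists_extension_of_subsingleton_ext (Y := ModuleCat.of R R)
      (A := ModuleCat.of R (LinearMap.range d)) (f := (LinearMap.range d).subtype) (g := p)
      (Submodule.subtype_injective _) (by
        rw [LinearMap.exact_iff, hd.exact.linearMap_ker_eq, Submodule.range_subtype])
      hd.surjective
      ((LinearMap.ker d).liftQ f hf ∘ₗ d.quotKerEquivRange.symm.toLinearMap)
    refine ⟨ψ, ?_⟩
    ext x
    have := LinearMap.congr_fun hψ ⟨d x, x, rfl⟩
    refine this.trans ?_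
    have h2 : d.quotKerEquivRange.symm ⟨d x, x, rfl⟩ = (LinearMap.ker d).mkQ x :=
      (LinearEquiv.symm_apply_eq _).2 rfl
    simp [h2]

/-- If `Extⁱ(M, R) = 0` for `1 ≤ i ≤ n`, then `M ≈ Tr Ωⁿ Tr Ωⁿ M`. -/
theorem IsTransposeSyzygy.stablyIso_of_isTransposeSyzygy [IsNoetherianRing R] {n : ℕ}
    {M A E : ModuleCat.{u} R} [Module.Finite R M]
    (hM : ∀ i < n, Subsingleton (Ext M (ModuleCat.of R R) (i + 1)))
    (hA : IsTransposeSyzygy n M A) (hE : IsTransposeSyzygy n A E) : StablyIso M E := by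
  obtain ⟨B, hB, hE⟩ := hE
  obtain ⟨P₁, P₀, d, p, hd⟩ := exists_isProjPresentation M
  have hL : IsTranspose M (ModuleCat.of R (DualCoker d)) :=
    ⟨P₁, P₀, d, p, hd, ⟨LinearEquiv.refl R _⟩⟩
  have := hL.finite
  obtain ⟨P₁', P₀', d', p', hd'⟩ := exists_isProjPresentation (ModuleCat.of R (DualCoker d))
  have hL' : IsTranspose (ModuleCat.of R (DualCoker d)) (ModuleCat.of R (DualCoker d')) :=
    ⟨P₁', P₀', d', p', hd', ⟨LinearEquiv.refl R _⟩⟩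
  exact (hL.stablyIso_of_isTranspose hL').trans
    (hE.stablyIso hL' (hA.stablyIso_transpose hM hB hL)).symm

end Exact

/-! ### Depth, vanishing of `Extⁱ(k, R)`, and the type. -/

section Depth

open Abelian IsLocalRing

variable {R : Type u} [CommRing R] [IsLocalRing R]

theorem support_residueModule :
    Module.support R (residueModule R) = PrimeSpectrum.zeroLocus (maximalIdeal R) := by
  change Module.support R (R ⧸ maximalIdeal R) = _
  rw [Module.support_eq_zeroLocus, Ideal.annihilator_quotient]

instance finite_residueModule : Module.Finite R (residueModule R) :=
  inferInstanceAs (Module.Finite R (R ⧸ maximalIdeal R))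

theorem smul_top_lt_top : maximalIdeal R • (⊤ : Submodule R (ModuleCat.of R R)) < ⊤ := by
  change maximalIdeal R • (⊤ : Ideal R) < ⊤
  rw [smul_eq_mul, Ideal.mul_top]
  exact lt_top_iff_ne_top.2 (Ideal.IsPrime.ne_top inferInstance)

theorem subsingleton_extResidue_of_lt [IsNoetherianRing R] {i : ℕ} (h : (i : ℕ∞) < ringDepth R) :
    Subsingleton (ExtResidue R i) := by
  simp only [ringDepth, lt_iSup_iff, Set.mem_ofPred_eq, Nat.cast_lt] at h
  obtain ⟨rs, ⟨hrs, hm⟩, hi⟩ := h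
  exact ModuleCat.subsingleton_ext_of_exists_isRegular (maximalIdeal R) (residueModule R)
    support_residueModule.le (ModuleCat.of R R) smul_top_lt_top rs hm hrs i hi

/-- By Rees's theorem, vanishing up to degree `t` would produce a regular sequence of length `t +
1`. -/
theorem not_subsingleton_extResidue [IsNoetherianRing R] {t : ℕ} (h : ringDepth R = (t : ℕ∞)) :
    ¬ Subsingleton (ExtResidue R t) := by
  intro ht
  obtain ⟨rs, hl, hm, hrs⟩ := ModuleCat.exists_isRegular_of_exists_subsingleton_ext
    (maximalIdeal R) (t + 1) (ModuleCat.of R R) smul_top_lt_top (residueModule R)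
    support_residueModule (fun i hi => by
      obtain hi | rfl := Nat.lt_succ_iff_lt_or_eq.1 hi
      · exact subsingleton_extResidue_of_lt (by rw [h]; exact_mod_cast hi)
      · exact ht)
  have : (rs.length : ℕ∞) ≤ ringDepth R := by
    unfold ringDepth
    exact le_iSup₂ (f := fun (rs : List R) (_ : rs ∈ {rs : List R |
      RingTheory.Sequence.IsRegular R rs ∧ ∀ r ∈ rs, r ∈ maximalIdeal R}) => (rs.length : ℕ∞))
      rs ⟨hrs, hm⟩
  rw [h, hl] at this
  have : t + 1 ≤ t := by exact_mod_cast this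
  omega

/-- A `k`-basis phrased with coefficients in `R`, since the coefficients will come from maps `Rʳ →
R`. -/
theorem exists_minimal_generators [IsNoetherianRing R] {t : ℕ} (h : ringDepth R = (t : ℕ∞)) :
    ∃ e : Fin (ringType R) → ExtResidue R t,
      (∀ z, ∃ a : Fin (ringType R) → R, ∑ j, a j • e j = z) ∧
      ∀ a : Fin (ringType R) → R, ∑ j, a j • e j = 0 → ∀ j, a j ∈ maximalIdeal R := by
  obtain rfl : (ringDepth R).toNat = t := by rw [h]; rfl
  let := extResidueModule R (ringDepth R).toNat
  have hsmul : ∀ (a : R) (x : ExtResidue R (ringDepth R).toNat), residue R a • x = a • x :=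
    fun _ _ => rfl
  have : IsScalarTower R (ResidueField R) (ExtResidue R (ringDepth R).toNat) :=
    ⟨fun a b x => by
      obtain ⟨b, rfl⟩ := residue_surjective b
      have : a • residue R b = residue R (a * b) := by
        rw [Algebra.smul_def, map_mul]; rfl
      rw [this, hsmul, hsmul, mul_smul]⟩
  have : Module.Finite (ResidueField R) (ExtResidue R (ringDepth R).toNat) :=
    Module.Finite.of_restrictScalars_finite R _ _
  let b : Module.Basis (Fin (ringType R)) (ResidueField R) (ExtResidue R (ringDepth R).toNat) :=
    Module.finBasis _ _
  refine ⟨b, fun z => ?_, fun a ha j => ?_⟩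
  · choose a ha using fun j => residue_surjective (b.repr z j)
    refine ⟨a, ?_⟩
    rw [← b.sum_repr z]
    exact Finset.sum_congr rfl fun j _ => by rw [← hsmul, ha]
  · rw [← residue_eq_zero_iff]
    exact Fintype.linearIndependent_iff.1 b.linearIndependent (fun j => residue R (a j)) ha j

end Depth

/-! ### Ext of free modules and finite powers, by coordinates. -/

section Coordinates

open Abelian

variable {R : Type u} [CommRing R]

theorem hom_pi_eq_sum {r : ℕ} (φ : ModuleCat.of R (Fin r → R) ⟶ ModuleCat.of R R) :
    φ = ∑ j, (φ.hom (Pi.single j 1) : R) •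
      (ModuleCat.ofHom (LinearMap.proj j) : ModuleCat.of R (Fin r → R) ⟶ ModuleCat.of R R) := by
  ext1
  rw [ModuleCat.hom_sum]
  ext j
  simp [Pi.single_apply]

/-- The identity of `X`, a summand of some `Rⁿ`, is a sum of maps factoring through `R`. -/
theorem ext_eq_zero_of_forall_dual {K X : ModuleCat.{u} R} [Module.Finite R X]
    [Module.Projective R X] {j : ℕ} (x : Ext K X j)
    (h : ∀ c : X ⟶ ModuleCat.of R R, x.comp (Ext.mk₀ c) (add_zero j) = 0) : x = 0 := by
  obtain ⟨n, f, hf⟩ := Module.Finite.exists_fin' R X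
  obtain ⟨g, hg⟩ := Module.projective_lifting_property f LinearMap.id hf
  let c : Fin n → (X ⟶ ModuleCat.of R R) := fun i => ModuleCat.ofHom (LinearMap.proj i ∘ₗ g)
  let s : Fin n → (ModuleCat.of R R ⟶ X) :=
    fun i => ModuleCat.ofHom (f ∘ₗ LinearMap.single R (fun _ => R) i)
  have hid : 𝟙 X = ∑ i, c i ≫ s i := by
    ext y
    rw [ModuleCat.hom_sum, LinearMap.sum_apply]
    change y = ∑ i, f (Pi.single i (g y i))
    rw [← map_sum, Finset.univ_sum_single]
    exact (LinearMap.congr_fun hg y).symm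
  rw [← Ext.comp_mk₀_id x, hid, Ext.mk₀_sum, Ext.comp_sum]
  refine Finset.sum_eq_zero fun i _ => ?_
  rw [← Ext.mk₀_comp_mk₀, ← Ext.comp_assoc_of_third_deg_zero, h, Ext.zero_comp]

theorem subsingleton_ext_right {K X : ModuleCat.{u} R} [Module.Finite R X]
    [Module.Projective R X] {j : ℕ} [Subsingleton (Ext K (ModuleCat.of R R) j)] :
    Subsingleton (Ext K X j) :=
  subsingleton_of_forall_eq 0 fun x => ext_eq_zero_of_forall_dual x fun _ => Subsingleton.elim _ _

theorem subsingleton_ext_pi (K : Type u) [AddCommGroup K] [Module R K] {Y : ModuleCat.{u} R}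
    (n : ℕ) {j : ℕ} [Subsingleton (Ext (ModuleCat.of R K) Y j)] :
    Subsingleton (Ext (ModuleCat.of R (Fin n → K)) Y j) := by
  refine subsingleton_of_forall_eq 0 fun x => ?_
  let c : Fin n → (ModuleCat.of R (Fin n → K) ⟶ ModuleCat.of R K) :=
    fun i => ModuleCat.ofHom (LinearMap.proj i)
  let s : Fin n → (ModuleCat.of R K ⟶ ModuleCat.of R (Fin n → K)) :=
    fun i => ModuleCat.ofHom (LinearMap.single R (fun _ => K) i)
  have hid : 𝟙 (ModuleCat.of R (Fin n → K)) = ∑ i, c i ≫ s i := by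
    ext1
    rw [ModuleCat.hom_sum]
    refine LinearMap.ext fun y => ?_
    rw [LinearMap.sum_apply]
    exact (Finset.univ_sum_single y).symm
  rw [← Ext.mk₀_id_comp x, hid, Ext.mk₀_sum, Ext.sum_comp]
  refine Finset.sum_eq_zero fun i _ => ?_
  rw [← Ext.mk₀_comp_mk₀_assoc, Subsingleton.elim ((Ext.mk₀ (s i)).comp x (zero_add j)) 0,
    Ext.comp_zero]

/-- If `Extⁱ(K, R) = 0` for `i < n + j` and `W` has projective dimension less than `n`, then
`Extʲ(K, W) = 0`. -/
theorem subsingleton_ext_of_hasProjectiveDimensionLT [IsNoetherianRing R] {K : ModuleCat.{u} R}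
    {n : ℕ} (W : ModuleCat.{u} R) [Module.Finite R W] (j : ℕ)
    (hK : ∀ i < n + j, Subsingleton (Ext K (ModuleCat.of R R) i))
    (hW : HasProjectiveDimensionLT W n) : Subsingleton (Ext K W j) := by
  induction n generalizing W j with
  | zero =>
    have h0 : 𝟙 W = 0 := (isZero_of_hasProjectiveDimensionLT_zero W).eq_of_src _ _
    refine subsingleton_of_forall_eq 0 fun x => ?_
    rw [← Ext.comp_mk₀_id x, h0, Ext.mk₀_zero, Ext.comp_zero]
  | succ n ih =>
    have := hK j (by omega)
    cases n with
    | zero =>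
      have : Projective W := projective_iff_hasProjectiveDimensionLT_one.2 hW
      have : Module.Projective R W := W.projective_of_module_projective
      exact subsingleton_ext_right
    | succ n =>
      obtain ⟨m, p, hp⟩ := Module.Finite.exists_fin' R W
      have hS := shortExact_ker (P := ModuleCat.of R (Fin m → R)) hp
      have : Projective (ModuleCat.of R (Fin m → R)) :=
        ModuleCat.projective_of_categoryTheory_projective _
      have hP : HasProjectiveDimensionLT (ModuleCat.of R (Fin m → R)) (n + 1) :=
        hasProjectiveDimensionLT_of_ge _ 1 (n + 1) (by omega)
      have h1 := ih (ModuleCat.of R (LinearMap.ker p)) (j + 1) (fun i hi => hK i (by omega))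
        (hS.hasProjectiveDimensionLT_X₁ (n + 1) hP hW)
      have h2 : Subsingleton (Ext K (ModuleCat.of R (Fin m → R)) j) := subsingleton_ext_right
      refine subsingleton_of_forall_eq 0 fun x => ?_
      obtain ⟨y, hy⟩ := Ext.covariant_sequence_exact₃ K hS x (rfl : j + 1 = j + 1)
        (h1.elim _ _)
      have : y = 0 := h2.elim _ _
      rw [← hy, this]
      exact Ext.zero_comp ..

end Coordinates

/-! ### The dualised resolution, built one step at a time. -/

section Stage

open Abelian IsLocalRing

variable {R : Type u} [CommRing R] [IsLocalRing R]

theorem smul_ext_eq_zero {a : R} (ha : a ∈ maximalIdeal R) {n : ℕ} (x : ExtResidue R n) :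
    a • x = 0 :=
  @isTorsionBySet_extResidue R _ _ n x ⟨a, ha⟩

/-- A surjection `w : P* → W` and a class `ω ∈ Extⁿ(W, Rʳ)`, for `P` a projective cover of an
`n`-th syzygy `S` of `kʳ`, making `W` dual to the first `n` steps of a resolution of `kʳ`. -/
structure IsDualStage (t r n : ℕ) {S P W : ModuleCat.{u} R} (q : P →ₗ[R] S)
    (w : Module.Dual R P →ₗ[R] W) (ω : Ext W (ModuleCat.of R (Fin r → R)) n) : Prop where
  finite : Module.Finite R P
  projective : Module.Projective R P
  surjective_q : Function.Surjective q
  surjective_w : Function.Surjective w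
  ker_le : LinearMap.ker w ≤ LinearMap.range q.dualMap
  le_ker : n < t → LinearMap.range q.dualMap ≤ LinearMap.ker w
  isNthSyzygy : IsNthSyzygy n (ModuleCat.of R (Fin r → ResidueField R)) S
  isTransposeSyzygy : ∀ m, n = m + 1 →
    IsTransposeSyzygy m (ModuleCat.of R (Fin r → ResidueField R)) W
  torsionless : n ≠ 0 → ∀ x : P, (∀ g : S →ₗ[R] R, g (q x) = 0) → q x = 0
  projectiveDimension_le : HasProjectiveDimensionLT W (n + 1)
  subsingleton_ext : ∀ i, i + 1 < n → Subsingleton (Ext W (ModuleCat.of R R) (i + 1))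
  generates : ∀ x : Ext W (ModuleCat.of R R) n,
    ∃ φ : ModuleCat.of R (Fin r → R) ⟶ ModuleCat.of R R, ω.comp (Ext.mk₀ φ) (add_zero n) = x
  smul_eq_zero : n ≠ 0 → ∀ a ∈ maximalIdeal R,
    ∀ φ : ModuleCat.of R (Fin r → R) ⟶ ModuleCat.of R R,
      ω.comp (Ext.mk₀ (a • φ)) (add_zero n) = 0
  -- The maximal ideal need not kill `Hom(W, R)`, so `smul_eq_zero` is unavailable at `n = 0`. This
  -- substitute, applied to the class of the first extension, yields it at `n = 1`.
  comp_smul_eq_zero : n = 0 → ∀ {W' : ModuleCat.{u} R} (δ : Ext W' W 1),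
    (∀ (f : W ⟶ ModuleCat.of R R) (x : P), (∀ ψ, f.hom (w ψ) = ψ x) → q x = 0 →
      δ.comp (Ext.mk₀ f) (add_zero 1) = 0) →
    ∀ a ∈ maximalIdeal R, ∀ φ : ModuleCat.of R (Fin r → R) ⟶ ModuleCat.of R R,
      δ.comp (ω.comp (Ext.mk₀ (a • φ)) (add_zero n)) (rfl : 1 + n = 1 + n) = 0
  comp_eq_zero : n = 0 → ∀ (f : W ⟶ ModuleCat.of R R) (x : P), (∀ ψ, f.hom (w ψ) = ψ x) →
    q x = 0 → ∀ (j : ℕ) (y : Ext (residueModule R) W j), y.comp (Ext.mk₀ f) (add_zero j) = 0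
  lifts : ∀ (j l : ℕ) (h : j + n = l), l ≤ t →
    ∀ y : Ext (residueModule R) (ModuleCat.of R (Fin r → R)) l,
      ∃ x : Ext (residueModule R) W j, x.comp ω h = y

theorem exists_isDualStage_zero {t : ℕ} (r : ℕ)
    (hk : ∀ i < t, Subsingleton (ExtResidue R i)) :
    ∃ (S P W : ModuleCat.{u} R) (q : P →ₗ[R] S) (w : Module.Dual R P →ₗ[R] W)
      (ω : Ext W (ModuleCat.of R (Fin r → R)) 0), IsDualStage t r 0 q w ω := by
  let V := ModuleCat.of R (Fin r → R)
  let M := ModuleCat.of R (Fin r → ResidueField R)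
  let W := ModuleCat.of R (Module.Dual R (Fin r → R))
  let q : V →ₗ[R] M := LinearMap.pi fun j => Algebra.linearMap R (ResidueField R) ∘ₗ
    LinearMap.proj j
  let e : W ≃ₗ[R] V := ((Pi.basisFun R (Fin r)).constr R).symm
  have hfin : Module.Finite R V := inferInstanceAs (Module.Finite R (Fin r → R))
  have hproj : Module.Projective R V := inferInstanceAs (Module.Projective R (Fin r → R))
  have hq : ∀ x : V, q x = 0 → ∀ j, (x j : R) ∈ maximalIdeal R := fun x hx j =>
    (residue_eq_zero_iff _).1 (congrFun hx j)
  refine ⟨M, V, W, q, LinearMap.id, Ext.mk₀ e.toModuleIso.hom,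
    { finite := hfin
      projective := hproj
      surjective_q := ?_
      surjective_w := Function.surjective_id
      ker_le := ?_
      le_ker := ?_
      isNthSyzygy := ⟨LinearEquiv.refl R _⟩
      isTransposeSyzygy := fun m h => by omega
      torsionless := fun h => absurd rfl h
      projectiveDimension_le := ?_
      subsingleton_ext := fun i hi => by omega
      generates := ?_
      smul_eq_zero := fun h => absurd rfl h
      comp_smul_eq_zero := ?_
      comp_eq_zero := ?_
      lifts := ?_ }⟩
  · intro y
    choose x hx using fun j => residue_surjective (y j)
    exact ⟨x, funext hx⟩
  · rw [LinearMap.ker_id]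
    exact bot_le
  · rintro ht _ ⟨g, rfl⟩
    have h0 := hk 0 ht
    have : Subsingleton (Ext M (ModuleCat.of R R) 0) :=
      subsingleton_ext_pi (ResidueField R) (Y := ModuleCat.of R R) r
    have hg : (ModuleCat.ofHom g : M ⟶ ModuleCat.of R R) = 0 :=
      (Ext.mk₀_bijective _ _).1 (Subsingleton.elim _ _)
    have hg : g = 0 := congrArg ModuleCat.Hom.hom hg
    rw [hg]
    exact Submodule.zero_mem _
  · have : Projective W := ModuleCat.projective_of_categoryTheory_projective
      (ModuleCat.of R (Module.Dual R (Fin r → R)))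
    infer_instance
  · intro x
    obtain ⟨f, rfl⟩ := (Ext.mk₀_bijective _ _).2 x
    refine ⟨e.toModuleIso.inv ≫ f, ?_⟩
    rw [Ext.mk₀_comp_mk₀, Iso.hom_inv_id_assoc]
  · intro _ W' δ hδ a ha φ
    rw [Ext.mk₀_comp_mk₀]
    -- Functionals on `V*` are evaluations at points of `V`; for `a` in the maximal ideal, `a • x`
    -- lies in `ker q` because `q` is reduction modulo that ideal.
    obtain ⟨x, hx⟩ := (Module.evalEquiv R V).surjective (φ.hom ∘ₗ e.toLinearMap)
    refine hδ _ (a • x) (fun ψ => ?_) ?_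
    · rw [map_smul]
      change a • φ.hom (e ψ) = a • ψ x
      congr 1
      exact (LinearMap.congr_fun hx ψ).symm
    · rw [map_smul]
      funext j
      change a • (q x j : ResidueField R) = 0
      rw [Algebra.smul_def]
      change residue R a * _ = 0
      rw [(residue_eq_zero_iff a).2 ha, zero_mul]
  · intro _ f x hf hx j y
    -- Since `q x = 0`, the coefficients `x i` lie in the maximal ideal, which kills every `Extʲ(k,
    -- R)`.
    have h1 : f = ∑ i, (x i : R) • (e.toModuleIso.hom ≫
        (ModuleCat.ofHom (LinearMap.proj i) : V ⟶ ModuleCat.of R R)) := by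
      ext1
      rw [ModuleCat.hom_sum]
      refine LinearMap.ext fun ψ => ?_
      rw [LinearMap.sum_apply]
      refine (hf ψ).trans ?_
      have h2 : x = ∑ i, (x i : R) • (Pi.basisFun R (Fin r) i) := by
        conv_lhs => rw [← (Pi.basisFun R (Fin r)).sum_repr x]
        rfl
      conv_lhs => rw [h2]
      rw [map_sum]
      refine Finset.sum_congr rfl fun i _ => ?_
      rw [map_smul]
      rfl
    rw [h1, Ext.mk₀_sum, Ext.comp_sum]
    refine Finset.sum_eq_zero fun i _ => ?_
    rw [Ext.mk₀_smul, Ext.comp_smul]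
    exact smul_ext_eq_zero (hq x hx i) _
  · rintro j l h - y
    obtain rfl : j = l := h
    refine ⟨y.comp (Ext.mk₀ e.toModuleIso.inv) (add_zero j), ?_⟩
    rw [Ext.comp_assoc_of_third_deg_zero, Ext.mk₀_comp_mk₀, Iso.inv_hom_id, Ext.comp_mk₀_id]

theorem IsDualStage.exists_succ [IsNoetherianRing R] {t r n : ℕ}
    (hk : ∀ i < t, Subsingleton (ExtResidue R i)) (hn : n < t)
    {S P W : ModuleCat.{u} R} {q : P →ₗ[R] S} {w : Module.Dual R P →ₗ[R] W}
    {ω : Ext W (ModuleCat.of R (Fin r → R)) n} (h : IsDualStage t r n q w ω) :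
    ∃ (S' P' W' : ModuleCat.{u} R) (q' : P' →ₗ[R] S') (w' : Module.Dual R P' →ₗ[R] W')
      (ω' : Ext W' (ModuleCat.of R (Fin r → R)) (1 + n)), IsDualStage t r (1 + n) q' w' ω' := by
  have := h.finite
  have := h.projective
  have := h.projectiveDimension_le
  obtain ⟨m, p, hp⟩ := Module.Finite.exists_fin' R (LinearMap.ker q)
  let S' := ModuleCat.of R (LinearMap.ker q)
  let P' := ModuleCat.of R (Fin m → R)
  let d : P' →ₗ[R] P := (LinearMap.ker q).subtype ∘ₗ p
  let X := ModuleCat.of R (Module.Dual R P')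
  let W' := ModuleCat.of R (DualCoker d)
  have hfin : Module.Finite R P' := inferInstanceAs (Module.Finite R (Fin m → R))
  have hproj : Module.Projective R P' := inferInstanceAs (Module.Projective R (Fin m → R))
  have hXfin : Module.Finite R X := inferInstanceAs (Module.Finite R (Module.Dual R P'))
  have hXproj : Module.Projective R X := inferInstanceAs (Module.Projective R (Module.Dual R P'))
  have hX : Projective X := X.projective_of_categoryTheory_projective
  have hd : Function.Exact d q := by
    rw [LinearMap.exact_iff, LinearMap.range_comp, LinearMap.range_eq_top.2 hp, Submodule.map_top,
      Submodule.range_subtype]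
  have hpres : IsProjPresentation d q :=
    ⟨hfin, hproj, h.finite, h.projective, hd, h.surjective_q⟩
  -- Exactness of the dual complex at `P*`: both kernels are the functionals on `P` factoring
  -- through `q`. So `d*` induces an embedding `u` of `W` into `P'*`, with cokernel `W'`.
  have hker : LinearMap.ker w = LinearMap.ker d.dualMap := by
    apply le_antisymm
    · refine h.ker_le.trans ?_
      rintro _ ⟨g, rfl⟩
      refine LinearMap.ext fun x => ?_
      change g (q (d x)) = 0
      rw [hd.apply_apply_eq_zero, map_zero]
    · intro f hf
      refine h.le_ker hn ?_
      have hf' : LinearMap.ker q ≤ LinearMap.ker f := fun x hx => by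
        obtain ⟨y, rfl⟩ := (hd x).1 hx
        exact LinearMap.congr_fun hf y
      refine ⟨(LinearMap.ker q).liftQ f hf' ∘ₗ
        (q.quotKerEquivOfSurjective h.surjective_q).symm.toLinearMap, ?_⟩
      ext x
      have : (q.quotKerEquivOfSurjective h.surjective_q).symm (q x) = (LinearMap.ker q).mkQ x :=
        (LinearEquiv.symm_apply_eq _).2 rfl
      simp [this]
  let u : W →ₗ[R] X := (LinearMap.ker w).liftQ d.dualMap hker.le ∘ₗ
    (w.quotKerEquivOfSurjective h.surjective_w).symm.toLinearMap
  have hu : ∀ φ, u (w φ) = d.dualMap φ := fun φ => by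
    have : (w.quotKerEquivOfSurjective h.surjective_w).symm (w φ) = (LinearMap.ker w).mkQ φ :=
      (LinearEquiv.symm_apply_eq _).2 rfl
    simp [u, this]
  have huinj : Function.Injective u := by
    rw [← LinearMap.ker_eq_bot, LinearMap.ker_eq_bot']
    intro y hy
    obtain ⟨φ, rfl⟩ := h.surjective_w y
    rw [hu] at hy
    exact hker.ge hy
  let v : X →ₗ[R] W' := (LinearMap.range d.dualMap).mkQ
  have huv : Function.Exact u v := by
    rw [LinearMap.exact_iff, Submodule.ker_mkQ]
    apply le_antisymm
    · rintro _ ⟨φ, rfl⟩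
      exact ⟨w φ, hu φ⟩
    · rintro _ ⟨y, rfl⟩
      obtain ⟨φ, rfl⟩ := h.surjective_w y
      exact ⟨φ, (hu φ).symm⟩
  have hv : Function.Surjective v := Submodule.mkQ_surjective _
  have hS := shortExact_of_exact huinj huv hv
  -- If `x = d y`, evaluation at `x` extends along `u` to evaluation at `y`, so the extension class
  -- kills it.
  have hδ : ∀ (f : W ⟶ ModuleCat.of R R) (x : P), (∀ ψ, f.hom (w ψ) = ψ x) → q x = 0 →
      hS.extClass.comp (Ext.mk₀ f) (add_zero 1) = 0 := by
    intro f x hf hx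
    obtain ⟨y, rfl⟩ := (hd x).1 hx
    have h1 : f = ModuleCat.ofHom u ≫ ModuleCat.ofHom (Module.Dual.eval R P' y) := by
      ext1
      refine LinearMap.ext fun z => ?_
      obtain ⟨ψ, rfl⟩ := h.surjective_w z
      refine (hf ψ).trans ?_
      change _ = u (w ψ) y
      rw [hu]
      rfl
    rw [h1, ← Ext.mk₀_comp_mk₀]
    exact hS.extClass_comp_assoc _
  have hrep : ∀ f : W ⟶ ModuleCat.of R R, ∃ x : P, ∀ ψ, f.hom (w ψ) = ψ x := fun f => by
    obtain ⟨x, hx⟩ := (Module.evalEquiv R P).surjective (f.hom ∘ₗ w)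
    exact ⟨x, fun ψ => (LinearMap.congr_fun hx ψ).symm⟩
  have hXext : ∀ j, Subsingleton (Ext X (ModuleCat.of R R) (j + 1)) := fun j =>
    subsingleton_ext_of_projective X _ j
  refine ⟨S', P', W', p, v, hS.extClass.comp ω rfl,
    { finite := hfin
      projective := hproj
      surjective_q := hp
      surjective_w := hv
      ker_le := ?_
      le_ker := ?_
      isNthSyzygy := ?_
      isTransposeSyzygy := ?_
      torsionless := ?_
      projectiveDimension_le := ?_
      subsingleton_ext := ?_
      generates := ?_
      smul_eq_zero := ?_
      comp_smul_eq_zero := fun h0 => by omega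
      comp_eq_zero := fun h0 => by omega
      lifts := ?_ }⟩
  · rw [Submodule.ker_mkQ]
    rintro _ ⟨φ, rfl⟩
    exact ⟨φ ∘ₗ (LinearMap.ker q).subtype, rfl⟩
  · rintro hn' _ ⟨g, rfl⟩
    rw [Submodule.ker_mkQ]
    have := hk (0 + n + 1) (by omega)
    have : Subsingleton (Ext (ModuleCat.of R (Fin r → ResidueField R)) (ModuleCat.of R R)
      (0 + n + 1)) := subsingleton_ext_pi (ResidueField R) (Y := ModuleCat.of R R) r
    have hext : Subsingleton (Ext S (ModuleCat.of R R) 1) :=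
      h.isNthSyzygy.subsingleton_ext (i := 0)
    obtain ⟨ψ, hψ⟩ := exists_extension_of_subsingleton_ext (A := S') (Y := ModuleCat.of R R)
      (Submodule.subtype_injective _) (exact_subtype_ker q) h.surjective_q g
    exact ⟨ψ, by rw [← hψ]; rfl⟩
  · rw [add_comm]
    exact ⟨S, h.isNthSyzygy, .of_ker q h.surjective_q (.refl R _)⟩
  · intro m' hm'
    obtain rfl : n = m' := by omega
    exact ⟨S, h.isNthSyzygy, P', P, d, q, hpres, ⟨.refl R _⟩⟩
  · intro _ x hx
    apply Subtype.ext
    exact (Module.forall_dual_apply_eq_zero_iff R (d x)).1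
      fun ξ => hx (ξ ∘ₗ (LinearMap.ker q).subtype)
  · rw [show 1 + n + 1 = (n + 1) + 1 by omega]
    refine hS.hasProjectiveDimensionLT_X₃ (n + 1) h.projectiveDimension_le ?_
    exact hasProjectiveDimensionLT_of_ge X 1 _ (by omega)
  · intro i hi
    obtain _ | i := i
    · refine subsingleton_of_forall_eq 0 fun x => ?_
      obtain ⟨y, rfl⟩ := Ext.contravariant_sequence_exact₃ hS _ x ((hXext 0).elim _ _)
        (add_zero 1)
      obtain ⟨f, rfl⟩ := (Ext.mk₀_bijective _ _).2 y
      obtain ⟨x, hx⟩ := hrep f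
      refine hδ f x hx (h.torsionless (by omega) x fun g => ?_)
      -- `Ext¹(W', R)` is the obstruction to extending `f` along `u`. As `w` kills `S*`, every
      -- functional on `S` vanishes at `q x`; `S` is torsionless, so `q x = 0` and `hδ` applies.
      rw [← LinearMap.dualMap_apply, ← hx]
      have : w (q.dualMap g) = 0 := h.le_ker hn ⟨g, rfl⟩
      rw [this, map_zero]
    · have := h.subsingleton_ext i (by omega)
      have := hXext (i + 1)
      exact subsingleton_ext_X₃ hS (i := i + 1) (by omega)
  · intro x
    have hX' : Subsingleton (Ext X (ModuleCat.of R R) (1 + n)) := by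
      rw [add_comm]
      exact hXext n
    obtain ⟨y, rfl⟩ := Ext.contravariant_sequence_exact₃ hS _ x (hX'.elim _ _) rfl
    obtain ⟨φ, rfl⟩ := h.generates y
    exact ⟨φ, Ext.comp_assoc_of_third_deg_zero ..⟩
  · intro _ a ha φ
    rw [Ext.comp_assoc_of_third_deg_zero]
    by_cases h0 : n = 0
    · exact h.comp_smul_eq_zero h0 _ hδ a ha φ
    · rw [h.smul_eq_zero h0 a ha φ, Ext.comp_zero]
  · intro j l hl hlt y
    obtain ⟨x, rfl⟩ := h.lifts (j + 1) l (by omega) hlt y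
    -- The obstruction to lifting `x` along the connecting class. It vanishes for degree reasons
    -- unless `j + 1 = t`, which forces `n = 0`; there `comp_eq_zero` applies, so minimality is used
    -- only at the first step of the resolution.
    have hx : x.comp (Ext.mk₀ (ModuleCat.ofHom u : W ⟶ X)) (add_zero (j + 1)) = 0 := by
      refine ext_eq_zero_of_forall_dual _ fun c => ?_
      by_cases hj : j + 1 < t
      · exact (hk (j + 1) hj).elim _ _
      · rw [Ext.comp_assoc_of_third_deg_zero, Ext.mk₀_comp_mk₀]
        obtain ⟨y, hy⟩ := (Module.evalEquiv R P').surjective c.hom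
        refine h.comp_eq_zero (by omega) _ (d y) (fun ψ => ?_) (hd.apply_apply_eq_zero y) _ _
        change c.hom (u (w ψ)) = _
        rw [hu, ← hy]
        rfl
    obtain ⟨z, rfl⟩ := Ext.covariant_sequence_exact₁ _ hS x hx rfl
    exact ⟨z, (Ext.comp_assoc _ _ _ _ _ (by omega)).symm⟩

theorem exists_isDualStage [IsNoetherianRing R] {t : ℕ} (r n : ℕ)
    (hk : ∀ i < t, Subsingleton (ExtResidue R i)) (hn : n ≤ t) :
    ∃ (S P W : ModuleCat.{u} R) (q : P →ₗ[R] S) (w : Module.Dual R P →ₗ[R] W)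
      (ω : Ext W (ModuleCat.of R (Fin r → R)) n), IsDualStage t r n q w ω := by
  induction n with
  | zero => exact exists_isDualStage_zero r hk
  | succ n ih =>
    obtain ⟨S, P, W, q, w, ω, h⟩ := ih (by omega)
    rw [add_comm]
    exact h.exists_succ hk (by omega)

end Stage

/-! ### Embedding the residue field in `W`. -/

section Approximation

open Abelian IsLocalRing

variable {R : Type u} [CommRing R] [IsLocalRing R]

/-- The residue field is a simple module. -/
theorem injective_of_ne_zero {W : ModuleCat.{u} R} (i : residueModule R →ₗ[R] W) (hi : i ≠ 0) :
    Function.Injective i := by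
  rw [← LinearMap.ker_eq_bot, LinearMap.ker_eq_bot']
  intro x hx
  by_contra hx0
  refine hi (LinearMap.ext fun y => ?_)
  have hx0 : (x : ResidueField R) ≠ 0 := hx0
  obtain ⟨c, hc⟩ := residue_surjective ((y : ResidueField R) * (x : ResidueField R)⁻¹)
  have : y = c • x := by
    rw [Algebra.smul_def]
    change _ = residue R c * _
    rw [hc, inv_mul_cancel_right₀ hx0]
  rw [this, map_smul, hx, smul_zero, LinearMap.zero_apply]

/-- The residue field embeds in a module `W` of projective dimension `t`, with cokernel `C`
satisfying `Extⁱ(C, R) = 0` for `1 ≤ i ≤ t + 1`. -/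
theorem exists_residueModule_embedding [IsNoetherianRing R] {t : ℕ}
    (ht : ringDepth R = (t : ℕ∞)) :
    ∃ (W C : ModuleCat.{u} R) (i : residueModule R →ₗ[R] W) (p : W →ₗ[R] C),
      Module.Finite R W ∧ Module.Finite R C ∧
      Function.Injective i ∧ Function.Exact i p ∧ Function.Surjective p ∧
      projectiveDimension W = ((t : ℕ∞) : WithBot ℕ∞) ∧
      (∀ j < t + 1, Subsingleton (Ext C (ModuleCat.of R R) (j + 1))) ∧
      ∀ m, t = m + 1 →
        IsTransposeSyzygy m (ModuleCat.of R (Fin (ringType R) → ResidueField R)) W := by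
  have hk : ∀ i < t, Subsingleton (ExtResidue R i) := fun i hi =>
    subsingleton_extResidue_of_lt (by rw [ht]; exact_mod_cast hi)
  obtain ⟨e, hspan, hmin⟩ := exists_minimal_generators ht
  obtain ⟨S, P, W, q, w, ω, h⟩ := exists_isDualStage (ringType R) t hk le_rfl
  let V := ModuleCat.of R (Fin (ringType R) → R)
  let s : Fin (ringType R) → (ModuleCat.of R R ⟶ V) := fun j =>
    ModuleCat.ofHom (LinearMap.single R (fun _ => R) j)
  -- The class in `Extᵗ(k, Rʳ)` with coordinates `e j`; its preimage in `Hom(k, W)` is the embedding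
  -- sought.
  let y : Ext (residueModule R) V t := ∑ j, (e j).comp (Ext.mk₀ (s j)) (add_zero t)
  have hy : ∀ φ : V ⟶ ModuleCat.of R R,
      y.comp (Ext.mk₀ φ) (add_zero t) = ∑ j, (φ.hom (Pi.single j 1) : R) • e j := by
    intro φ
    rw [Ext.sum_comp]
    refine Finset.sum_congr rfl fun j _ => ?_
    have : s j ≫ φ = (φ.hom (Pi.single j 1) : R) • 𝟙 (ModuleCat.of R R) := by
      ext
      change φ.hom (Pi.single j 1) = (φ.hom (Pi.single j 1) : R) • (1 : R)
      rw [smul_eq_mul, mul_one]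
    rw [Ext.comp_assoc_of_third_deg_zero, Ext.mk₀_comp_mk₀, this, Ext.smul_eq_comp_mk₀]
  obtain ⟨x, hx⟩ := h.lifts 0 t (zero_add t) le_rfl y
  obtain ⟨i, rfl⟩ := (Ext.mk₀_bijective _ _).2 x
  have hφ : ∀ φ : V ⟶ ModuleCat.of R R,
      (Ext.mk₀ i).comp (ω.comp (Ext.mk₀ φ) (add_zero t)) (zero_add t) =
        ∑ j, (φ.hom (Pi.single j 1) : R) • e j := fun φ => by
    rw [← hy, ← hx, Ext.comp_assoc_of_third_deg_zero]
  have hsurj : ∀ z : ExtResidue R t, ∃ x : Ext W (ModuleCat.of R R) t,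
      (Ext.mk₀ i).comp x (zero_add t) = z := by
    intro z
    obtain ⟨a, rfl⟩ := hspan z
    let φ : V ⟶ ModuleCat.of R R := ModuleCat.ofHom (Fintype.linearCombination R a)
    refine ⟨ω.comp (Ext.mk₀ φ) (add_zero t), ?_⟩
    rw [hφ]
    refine Finset.sum_congr rfl fun j _ => ?_
    congr 1
    change Fintype.linearCombination R a (Pi.single j 1) = a j
    rw [Fintype.linearCombination_apply_single, one_smul]
  -- A relation among the `e j` has coefficients in the maximal ideal, which kills the coordinates
  -- of `ω` once `t ≠ 0`. The case `t = 0` is not needed, as only positive degrees of `Ext(C, R)`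
  -- matter.
  have hinj : t ≠ 0 → ∀ x : Ext W (ModuleCat.of R R) t,
      (Ext.mk₀ i).comp x (zero_add t) = 0 → x = 0 := by
    intro h0 x hx
    obtain ⟨φ, rfl⟩ := h.generates x
    rw [hφ] at hx
    have := hmin _ hx
    rw [hom_pi_eq_sum φ, Ext.mk₀_sum, Ext.comp_sum]
    exact Finset.sum_eq_zero fun j _ => h.smul_eq_zero h0 _ (this j) _
  have hi0 : i ≠ 0 := by
    rintro rfl
    refine not_subsingleton_extResidue ht (subsingleton_of_forall_eq 0 fun z => ?_)
    obtain ⟨x, rfl⟩ := hsurj z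
    rw [Ext.mk₀_zero, Ext.zero_comp]
  have hi : Function.Injective i.hom := injective_of_ne_zero i.hom fun h0 =>
    hi0 (ModuleCat.hom_ext h0)
  have := h.finite
  have := h.projective
  have hWfin : Module.Finite R W := Module.Finite.of_surjective w h.surjective_w
  let C := ModuleCat.of R (W ⧸ LinearMap.range i.hom)
  let p : W →ₗ[R] C := (LinearMap.range i.hom).mkQ
  have hp : Function.Surjective p := Submodule.mkQ_surjective _
  have hip : Function.Exact i.hom p := by
    rw [LinearMap.exact_iff, Submodule.ker_mkQ]
  have hS := shortExact_of_exact hi hip hp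
  have hpd := h.projectiveDimension_le
  refine ⟨W, C, i.hom, p, hWfin, inferInstanceAs (Module.Finite R (W ⧸ LinearMap.range i.hom)),
    hi, hip, hp, ?_, ?_, h.isTransposeSyzygy⟩
  · refine le_antisymm ((projectiveDimension_le_iff W t).2 hpd) ?_
    -- Projective dimension below `t` would force `Hom(k, W) = 0`.
    refine (projectiveDimension_ge_iff W t).2 fun hW => hi0 ?_
    have := subsingleton_ext_of_hasProjectiveDimensionLT (K := residueModule R) W 0 hk hW
    exact (Ext.mk₀_bijective _ _).1 (Subsingleton.elim _ _)
  · intro j hj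
    refine subsingleton_of_forall_eq 0 fun z => ?_
    have hz : (Ext.mk₀ (ModuleCat.ofHom p : W ⟶ C)).comp z (zero_add (j + 1)) = 0 := by
      -- `z` dies in `Extʲ⁺¹(W, R)`: that group is zero unless `j + 1 = t`, where `i` induces an
      -- injection.
      obtain hj | hj | hj : j + 1 < t ∨ j + 1 = t ∨ j = t := by omega
      · exact (h.subsingleton_ext j hj).elim _ _
      · subst hj
        refine hinj (by omega) _ ?_
        rw [Ext.mk₀_comp_mk₀_assoc]
        have : i ≫ ModuleCat.ofHom p = 0 := (shortComplexOfExact i.hom p hip).zero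
        rw [this, Ext.mk₀_zero, Ext.zero_comp]
      · exact Ext.eq_zero_of_hasProjectiveDimensionLT _ (t + 1) (by omega)
    obtain ⟨x, rfl⟩ := Ext.contravariant_sequence_exact₃ hS _ z hz (add_comm 1 j)
    -- Now `z` comes from `Extʲ(k, R)`, which is zero for `j < t`; for `j = t` it is the image of
    -- `Extᵗ(W, R)`, which the connecting map kills.
    obtain hj | rfl : j < t ∨ j = t := by omega
    · rw [(hk j hj).elim x 0, Ext.comp_zero]
    · obtain ⟨x', rfl⟩ := hsurj x
      exact hS.extClass_comp_assoc _

end Approximation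

end SyzygyTranspose

/-! ### The theorem, for arbitrary choices of presentations. -/

theorem corollary2p5 (R : Type u) [CommRing R] [IsNoetherianRing R] [IsLocalRing R] (t : ℕ)
    (ht : SyzygyTranspose.ringDepth R = (t : ℕ∞)) :
    ∃ (W C : ModuleCat.{u} R) (i : SyzygyTranspose.residueModule R →ₗ[R] W) (p : W →ₗ[R] C),
      Module.Finite R W ∧ Module.Finite R C ∧
      Function.Injective i ∧ Function.Exact i p ∧ Function.Surjective p ∧
      CategoryTheory.projectiveDimension W = ((t : ℕ∞) : WithBot ℕ∞) ∧
      (∀ A E : ModuleCat.{u} R,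
        SyzygyTranspose.IsTransposeSyzygy t (SyzygyTranspose.residueModule R) A →
        SyzygyTranspose.IsTransposeSyzygy (t + 1) A E →
        SyzygyTranspose.StablyIso C E) ∧
      (0 < t → ∀ D : ModuleCat.{u} R,
        SyzygyTranspose.IsTransposeSyzygy (t - 1)
          (ModuleCat.of R (Fin (SyzygyTranspose.ringType R) → IsLocalRing.ResidueField R)) D →
        SyzygyTranspose.StablyIso W D) := by
  open SyzygyTranspose in
  obtain ⟨W, C, i, p, hW, hC, hi, hip, hp, hpd, hext, htr⟩ := exists_residueModule_embedding ht
  refine ⟨W, C, i, p, hW, hC, hi, hip, hp, hpd, ?_, ?_⟩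
  · rintro A E ⟨K, hK, hA⟩ hE
    obtain ⟨A', hA'fin, N, hN, hA'⟩ := exists_isTransposeSyzygy (t + 1) C
    -- `Ωᵗ⁺¹ C ≈ Ωᵗ k`, so their transposes agree stably and `C ≈ Tr Ωᵗ⁺¹ Tr Ωᵗ⁺¹ C` becomes the
    -- stated relation.
    have hKN : StablyIso N K := stablyIso_nthSyzygy_of_shortExact hi hip hp
      ((CategoryTheory.projectiveDimension_le_iff W t).1 hpd.le) hN hK
    obtain ⟨E', -, hE'⟩ := exists_isTransposeSyzygy (t + 1) A'
    exact (IsTransposeSyzygy.stablyIso_of_isTransposeSyzygy hext ⟨N, hN, hA'⟩ hE').trans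
      (hE'.stablyIso hE (hA'.stablyIso hA hKN))
  · intro h0 D hD
    exact (htr (t - 1) (by omega)).stablyIso hD (.refl _)
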